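/- Let $\nu\ge 2$ and consider the ferromagnetic nearest-neighbour Ising model on $\mathbb Z^\nu$ with coupling $J>0$, spins $\sigma_x=\sigma^3_x\in\{-1,1\}$ and zero external field: in a finite volume the Gibbs weight at temperature $T$ is $\exp\bigl(\frac JT\sum_{|x-y|=1}\sigma_x\sigma_y\bigr)$, the sum running over unordered nearest-neighbour pairs and $|\cdot|$ denoting the Euclidean length. Let $T_c$ be the supremum of the temperatures $T>0$ at which the spontaneous magnetisation (the magnetisation of the infinite-volume state with plus boundary conditions) is positive. Let the critical state $\omega$ be the infinite-volume state at $T=T_c$, obtained as the limit, along the cubes $\{-n,\dots,n\}^\nu$, of the Gibbs states with free boundary conditions. Let $$W(x)=\omega\bigl((\sigma_x-\omega(\sigma_x))(\sigma_0-\omega(\sigma_0))\bigr),\qquad x\in\mathbb Z^\nu,$$ be its connected two-point function. Standard Assumption: for some $\eta\in\mathbb R$, $W(x)$ is of the exact order $|x|^{-(\nu-2+\eta)}$ as $|x|\to\infty$, i.e. there are $c,d>0$ and $R_0<\infty$ with $c\,|x|^{-(\nu-2+\eta)}\le |W(x)|\le d\,|x|^{-(\nu-2+\eta)}$ for all $|x|\ge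 R_0$. **Theorem.** Under the Standard Assumption: 1. $W$ is not summable: $W\notin \ell^1(\mathbb Z^\nu)$. 2. $\sigma^3$ has anomalous fluctuations in the state $\omega$. Precisely, put $\alpha=(\nu+2-\eta)/2$. Then $\alpha>\nu/2$, and: (a) for every smooth cutoff $f:[0,\infty)\to[0,\infty)$ with $f=1$ on $[0,1]$ and $f=0$ on $[2,\infty)$, the smoothed fluctuation operators $$F_R^{\alpha}(\sigma^3)=R^{-\alpha}\sum_{x\in\mathbb Z^\nu}(\sigma_x-\omega(\sigma_x))\,f(|x|/R)$$ have variances bounded above and below: there are constants $c',d'>0$ with $c'\le\omega\bigl(F_R^\alpha(\sigma^3)^2\bigr)\le d'$ for all sufficiently large $R$; (b) for the balls $\Lambda_R=\{x\in\mathbb Z^\nu:|x|\le R\}$, the block variance $V_{\Lambda_R}=\omega\bigl(\bigl(\sum_{x\in\Lambda_R}(\sigma_x-\omega(\sigma_0))\bigr)^2\bigr)$ is of the exact order $|\Lambda_R|^{2\alpha/\nu}$ as $R\to\infty$, where $2\alpha/\nu>1$. -/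

import Mathlib

open Filter Topology Asymptotics MeasureTheory
open scoped ContDiff

noncomputable section

namespace Ising

/-- Sites of the lattice `ℤ^ν`. -/
abbrev Site (ν : ℕ) : Type := Fin ν → ℤ

/-- The Euclidean length `|x|` of a lattice site. -/
def length {ν : ℕ} (x : Site ν) : ℝ := √(∑ i, (x i : ℝ) ^ 2)

/-- The nearest neighbours of `x`: the sites `y` with `|x - y| = 1`. -/
def neighbours {ν : ℕ} (x : Site ν) : Finset (Site ν) :=
  (Finset.Icc (x - 1) (x + 1)).filter fun y => ∑ i, (x i - y i) ^ 2 = 1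

/-- The cube `{-n, …, n}^ν`. -/
def box (ν n : ℕ) : Finset (Site ν) :=
  Finset.Icc (fun _ => -(n : ℤ)) (fun _ => (n : ℤ))

/-- The lattice points of the closed Euclidean ball of radius `R` about the origin. -/
def ball (ν : ℕ) (R : ℝ) : Finset (Site ν) :=
  (box ν ⌈R⌉₊).filter fun x => length x ≤ R

/-! ### Finite volume -/

/-- The spins of a configuration on `Λ`, prolonged by the constant `b` outside `Λ`:
`b = 0` gives free boundary conditions, `b = 1` gives plus boundary conditions. -/
def extend {ν : ℕ} (Λ : Finset (Site ν)) (b : ℝ) (σ : Λ → ℤˣ) (x : Site ν) : ℝ :=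
  if h : x ∈ Λ then ((σ ⟨x, h⟩ : ℤ) : ℝ) else b

/-- The ferromagnetic nearest-neighbour energy at zero external field: `-J ∑ s_x s_y` over the
unordered nearest-neighbour pairs that meet `Λ`. A pair inside `Λ` occurs twice in the first
sum, whence the factor `1/2`; a pair with just one site in `Λ` occurs once in the second sum. -/
def energy {ν : ℕ} (J : ℝ) (Λ : Finset (Site ν)) (b : ℝ) (σ : Λ → ℤˣ) : ℝ :=
  -J * ((1 / 2) * ∑ x ∈ Λ, ∑ y ∈ neighbours x ∩ Λ, extend Λ b σ x * extend Λ b σ y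
    + ∑ x ∈ Λ, ∑ y ∈ neighbours x \ Λ, extend Λ b σ x * extend Λ b σ y)

/-- The finite-volume Gibbs expectation, at temperature `T`, of the observable `g`. -/
def gibbs {ν : ℕ} (J T : ℝ) (Λ : Finset (Site ν)) (b : ℝ) (g : (Site ν → ℝ) → ℝ) : ℝ :=
  (∑ σ : Λ → ℤˣ, g (extend Λ b σ) * Real.exp (-energy J Λ b σ / T)) /
    ∑ σ : Λ → ℤˣ, Real.exp (-energy J Λ b σ / T)

/-! ### Infinite volume -/

/-- The spontaneous magnetisation, i.e. the magnetisation of the plus state: the limit of the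
plus expectations of the spin at the origin (these do not increase with the cube, so that the
`limsup` is a limit). -/
def magnetisation (ν : ℕ) (J T : ℝ) : ℝ :=
  limsup (fun n : ℕ => gibbs J T (box ν n) 1 fun s => s 0) atTop

/-- The critical temperature: the supremum of the temperatures at which the spin-flip symmetry
is spontaneously broken. -/
def criticalTemp (ν : ℕ) (J : ℝ) : ℝ := sSup {T : ℝ | 0 < T ∧ 0 < magnetisation ν J T}

/-- Spin configurations on the whole lattice. -/
abbrev Config (ν : ℕ) : Type := Site ν → ℤˣ

/-- The spin `σ³_x` at the site `x`, as an observable. -/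
def spin {ν : ℕ} (x : Site ν) (σ : Config ν) : ℝ := ((σ x : ℤ) : ℝ)

/-- `μ` is the infinite-volume state at temperature `T` that is obtained as the thermodynamic
limit with free boundary conditions: the expectation of every local observable converges.
(Products of spins span the local observables, so that there is at most one such `μ`.) -/
def IsFreeState (ν : ℕ) (J T : ℝ) (μ : Measure (Config ν)) : Prop :=
  IsProbabilityMeasure μ ∧ ∀ A : Finset (Site ν),
    Tendsto (fun n : ℕ => gibbs J T (box ν n) 0 fun s => ∏ x ∈ A, s x) atTop
      (𝓝 (∫ σ, ∏ x ∈ A, spin x σ ∂μ))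

/-- The critical state: the infinite-volume state at the critical temperature. -/
def IsCriticalState (ν : ℕ) (J : ℝ) (μ : Measure (Config ν)) : Prop :=
  IsFreeState ν J (criticalTemp ν J) μ

/-- The connected two-point function
`W(x) = ω((σ_x - ω(σ_x)) (σ_0 - ω(σ_0)))`. -/
def connected {ν : ℕ} (μ : Measure (Config ν)) (x : Site ν) : ℝ :=
  ∫ σ, (spin x σ - ∫ τ, spin x τ ∂μ) * (spin 0 σ - ∫ τ, spin 0 τ ∂μ) ∂μ

/-- The connected two-point function is of the exact order `|x|^{-(ν-2+η)}` as `|x| → ∞`. -/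
def StandardAssumption {ν : ℕ} (μ : Measure (Config ν)) (η : ℝ) : Prop :=
  connected μ =Θ[comap length atTop] fun x : Site ν => length x ^ (-((ν : ℝ) - 2 + η))

/-! ### Fluctuations -/

/-- A smooth cutoff on `[0, ∞)`, equal to `1` on `[0, 1]` and to `0` on `[2, ∞)`. -/
structure IsCutoff (f : ℝ → ℝ) : Prop where
  smooth : ContDiffOn ℝ ∞ f (Set.Ici 0)
  nonneg : ∀ s, 0 ≤ s → 0 ≤ f s
  eq_one : ∀ s, 0 ≤ s → s ≤ 1 → f s = 1
  eq_zero : ∀ s, 2 ≤ s → f s = 0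

/-- The smoothed fluctuation operator
`F_R^α(σ³) = R^{-α} ∑_x (σ_x - ω(σ_x)) f(|x|/R)`; for `R > 0` only finitely many terms of
the sum are nonzero. -/
def fluctuation {ν : ℕ} (μ : Measure (Config ν)) (f : ℝ → ℝ) (α R : ℝ) (σ : Config ν) : ℝ :=
  R ^ (-α) * ∑' x : Site ν, (spin x σ - ∫ τ, spin x τ ∂μ) * f (length x / R)

/-- The variance `V_Λ` of the block variable `∑_{x ∈ Λ} σ_x`. -/
def blockVariance {ν : ℕ} (μ : Measure (Config ν)) (Λ : Finset (Site ν)) : ℝ :=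
  ∫ σ, (∑ x ∈ Λ, (spin x σ - ∫ τ, spin 0 τ ∂μ)) ^ 2 ∂μ

end Ising

end

/-! The heart of the matter is a lower bound at criticality: the sum of `W` over every cubic shell
is at least `3 ^ (-ν)`. Consider the sum of `tanh (J / T) ⟨σ_0 σ_x⟩` over the bonds that leave a
cube, taken in the free state of that cube. If it is below `1` at a temperature `T > 0`, the
Simon–Lieb inequality `gibbs_plus_le`, iterated in `gibbs_plus_le_pow`, bounds the plus
magnetisation by all its powers, so there is no spontaneous magnetisation at `T`. A boundary sum
lives in a finite volume and is continuous in `T`. Were it below `1` at `T_c`, it would be below `1`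
at slightly lower temperatures where the magnetisation is positive; hence `one_le_boundarySum`. By
Griffiths' second inequality free correlations increase with the volume to those of the critical
state, and so the boundary sum is at most `3 ^ ν` times the sum of `W` over the outermost shell
(`IsFreeState.boundarySum_le`).

Shell sums bounded below exclude summability. The Standard Assumption bounds them above by a
multiple of `m ^ (ν - 1 - s)` with `s = ν - 2 + η`, so `s ≤ ν - 1`, that is `η ≤ 1`, and `α > ν / 2`
follows. With `0 ≤ s ≤ ν - 1`, the double sum of `W (x - y)` over a ball is of order `R ^ (2ν - s) =
R ^ (2α)` (`PowerLaw.sum_ball_le`, `PowerLaw.le_sum_ball`). This gives the block variance; since `W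
≥ 0`, the smoothed variance lies between such double sums over the balls of radius `R` and `2R`.

The correlation inequalities share one device. Nonnegative combinations of sign characters of a
finite group are closed under products and have nonnegative sums, and a duplicated system is
parametrised by configurations `g` and `g * k`. -/

namespace Ising

open scoped NNReal

/-! ### Griffiths' inequalities on finite groups -/

section PositiveType

variable {G H : Type*} [CommGroup G] [CommGroup H]

/-- The real-valued functions given by the characters with values in `{-1, 1}`. -/
def signFunction (G : Type*) [CommGroup G] : (G →* ℤˣ) →* (G → ℝ) where
  toFun χ g := ((χ g : ℤ) : ℝ)
  map_one' := by ext; simp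
  map_mul' χ ψ := by ext; simp

@[simp] lemma signFunction_apply (χ : G →* ℤˣ) (g : G) :
    signFunction G χ g = ((χ g : ℤ) : ℝ) := rfl

/-- The cone of nonnegative combinations of sign characters. -/
def positiveType (G : Type*) [CommGroup G] : Subalgebra ℝ≥0 (G → ℝ) :=
  Algebra.adjoin ℝ≥0 (MonoidHom.mrange (signFunction G))

lemma signFunction_mem (χ : G →* ℤˣ) : signFunction G χ ∈ positiveType G :=
  Algebra.subset_adjoin ⟨χ, rfl⟩

lemma smul_mem_positiveType {f : G → ℝ} (hf : f ∈ positiveType G) {c : ℝ} (hc : 0 ≤ c) :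
    (fun g => c * f g) ∈ positiveType G :=
  (positiveType G).smul_mem hf (⟨c, hc⟩ : ℝ≥0)

lemma const_mem_positiveType {c : ℝ} (hc : 0 ≤ c) : (fun _ => c) ∈ positiveType G := by
  simpa using smul_mem_positiveType (one_mem (positiveType G)) hc

/-- Products of sign characters are sign characters, so the generated algebra is already their
linear span. This reduces statements linear in `f` to a single character. -/
lemma mem_span_of_mem_positiveType {f : G → ℝ} (hf : f ∈ positiveType G) :
    f ∈ Submodule.span ℝ≥0 (Set.range (signFunction G)) := by
  have : f ∈ (Algebra.adjoin ℝ≥0 (MonoidHom.mrange (signFunction G) : Set (G → ℝ))).toSubmodule :=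
    hf
  rwa [Algebra.adjoin_eq_span, Submonoid.closure_eq, MonoidHom.coe_mrange] at this

@[elab_as_elim]
lemma positiveType_induction {p : (G → ℝ) → Prop} (mem : ∀ χ, p (signFunction G χ)) (zero : p 0)
    (add : ∀ f g, p f → p g → p (f + g)) (smul : ∀ (c : ℝ≥0) f, p f → p (c • f))
    {f : G → ℝ} (hf : f ∈ positiveType G) : p f := by
  have := mem_span_of_mem_positiveType hf
  clear hf
  induction this using Submodule.span_induction with
  | mem f hf => obtain ⟨χ, rfl⟩ := hf; exact mem χ
  | zero => exact zero
  | add f g _ _ hf hg => exact add f g hf hg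
  | smul c f _ hf => exact smul c f hf

lemma comp_mem_positiveType {f : G → ℝ} (hf : f ∈ positiveType G) (π : H →* G) :
    (fun h => f (π h)) ∈ positiveType H := by
  refine positiveType_induction ?_ ?_ ?_ ?_ hf
  · intro χ; exact signFunction_mem (χ.comp π)
  · exact zero_mem _
  · intro f g hf hg; exact add_mem hf hg
  · intro c f hf; exact Subalgebra.smul_mem _ hf c

/-- Since `χ` takes the values `±1`, `exp (J χ) = cosh J + sinh J * χ`, with nonnegative
coefficients. -/
lemma exp_mem_positiveType {ι : Type*} (s : Finset ι) {J : ι → ℝ} (hJ : ∀ i ∈ s, 0 ≤ J i)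
    (χ : ι → G →* ℤˣ) :
    (fun g => Real.exp (∑ i ∈ s, J i * signFunction G (χ i) g)) ∈ positiveType G := by
  have : (fun g => Real.exp (∑ i ∈ s, J i * signFunction G (χ i) g)) =
      ∏ i ∈ s, ((fun _ => Real.cosh (J i)) + fun g => Real.sinh (J i) * signFunction G (χ i) g) := by
    ext g
    rw [Real.exp_sum, Finset.prod_apply]
    refine Finset.prod_congr rfl fun i _ => ?_
    rcases Int.units_eq_one_or (χ i g) with h | h
    · simp [h]
    · simp [h, ← sub_eq_add_neg]
  rw [this]
  exact prod_mem fun i hi => add_mem (const_mem_positiveType (Real.cosh_pos _).le)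
    (smul_mem_positiveType (signFunction_mem _) (Real.sinh_nonneg_iff.2 (hJ i hi)))

variable [Fintype G]

lemma sum_signFunction_nonneg (χ : G →* ℤˣ) : 0 ≤ ∑ g, signFunction G χ g := by
  by_cases h : ∃ k, χ k = -1
  · obtain ⟨k, hk⟩ := h
    have : ∑ g, signFunction G χ g = -∑ g, signFunction G χ g := by
      rw [← Finset.sum_neg_distrib]
      exact Fintype.sum_equiv (Equiv.mulLeft k) _ _ fun g => by simp [hk]
    linarith
  · push Not at h
    refine Finset.sum_nonneg fun g _ => ?_
    simp [(Int.units_eq_one_or (χ g)).resolve_right (h g)]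

/-- Griffiths' first inequality. -/
lemma sum_nonneg_of_mem_positiveType {f : G → ℝ} (hf : f ∈ positiveType G) : 0 ≤ ∑ g, f g := by
  refine positiveType_induction ?_ ?_ ?_ ?_ hf
  · intro χ; exact sum_signFunction_nonneg χ
  · simp
  · intro f g hf hg
    simpa [Finset.sum_add_distrib] using add_nonneg hf hg
  · intro c f hf
    simp only [Pi.smul_apply, ← Finset.smul_sum]
    exact smul_nonneg c.2 hf

/-- Write the difference as a double sum over `g`, `h` and put `h = g * k`. For fixed `k` the
summand becomes `(1 - ψ k)` times the character `φ * ψ` against a Gibbs weight with couplings `J i *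
(1 + χ i k)`, which are still nonnegative; the first inequality applies for each `k`. -/
lemma griffiths_signFunction {ι : Type*} (s : Finset ι) {J : ι → ℝ} (hJ : ∀ i ∈ s, 0 ≤ J i)
    (χ : ι → G →* ℤˣ) (φ ψ : G →* ℤˣ) :
    (∑ g, signFunction G φ g * Real.exp (∑ i ∈ s, J i * signFunction G (χ i) g)) *
      (∑ g, signFunction G ψ g * Real.exp (∑ i ∈ s, J i * signFunction G (χ i) g)) ≤
    (∑ g, signFunction G φ g * signFunction G ψ g *
        Real.exp (∑ i ∈ s, J i * signFunction G (χ i) g)) *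
      ∑ g, Real.exp (∑ i ∈ s, J i * signFunction G (χ i) g) := by
  set w : G → ℝ := fun g => Real.exp (∑ i ∈ s, J i * signFunction G (χ i) g) with hw
  have key : ∀ F : G → G → ℝ, ∑ g, ∑ h, F g h = ∑ k, ∑ g, F g (g * k) := fun F => by
    rw [Finset.sum_comm (f := fun k g => F g (g * k))]
    exact Finset.sum_congr rfl fun g _ => (Equiv.sum_comp (Equiv.mulLeft g) (F g)).symm
  rw [← sub_nonneg, Finset.sum_mul_sum, Finset.sum_mul_sum, ← Finset.sum_sub_distrib]
  simp only [← Finset.sum_sub_distrib]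
  rw [key]
  refine Finset.sum_nonneg fun k _ => ?_
  have : ∀ g, signFunction G φ g * signFunction G ψ g * w g * w (g * k) -
      signFunction G φ g * w g * (signFunction G ψ (g * k) * w (g * k)) =
      (1 - signFunction G ψ k) * (signFunction G (φ * ψ) g *
        Real.exp (∑ i ∈ s, (J i * (1 + signFunction G (χ i) k)) * signFunction G (χ i) g)) := by
    intro g
    have h1 : w g * w (g * k) = Real.exp (∑ i ∈ s,
        (J i * (1 + signFunction G (χ i) k)) * signFunction G (χ i) g) := by
      rw [hw, ← Real.exp_add, ← Finset.sum_add_distrib]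
      congr 1
      refine Finset.sum_congr rfl fun i _ => ?_
      simp only [signFunction_apply, map_mul, Units.val_mul, Int.cast_mul]
      ring
    rw [← h1]
    simp only [signFunction_apply, map_mul, Units.val_mul, Int.cast_mul, MonoidHom.mul_apply]
    ring
  rw [Finset.sum_congr rfl fun g _ => this g, ← Finset.mul_sum]
  have hb : ∀ θ : G →* ℤˣ, 0 ≤ 1 + signFunction G θ k ∧ 0 ≤ 1 - signFunction G θ k := fun θ => by
    rcases Int.units_eq_one_or (θ k) with h | h <;> simp [h]
  exact mul_nonneg (hb ψ).2 (sum_nonneg_of_mem_positiveType (mul_mem (signFunction_mem _)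
    (exp_mem_positiveType s (fun i hi => mul_nonneg (hJ i hi) (hb _).1) χ)))

/-- Griffiths' second inequality. -/
lemma griffiths {ι : Type*} (s : Finset ι) {J : ι → ℝ} (hJ : ∀ i ∈ s, 0 ≤ J i)
    (χ : ι → G →* ℤˣ) {f₁ f₂ : G → ℝ} (h₁ : f₁ ∈ positiveType G) (h₂ : f₂ ∈ positiveType G) :
    (∑ g, f₁ g * Real.exp (∑ i ∈ s, J i * signFunction G (χ i) g)) *
      (∑ g, f₂ g * Real.exp (∑ i ∈ s, J i * signFunction G (χ i) g)) ≤
    (∑ g, f₁ g * f₂ g * Real.exp (∑ i ∈ s, J i * signFunction G (χ i) g)) *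
      ∑ g, Real.exp (∑ i ∈ s, J i * signFunction G (χ i) g) := by
  refine positiveType_induction ?_ ?_ ?_ ?_ h₁
  · intro φ
    refine positiveType_induction ?_ ?_ ?_ ?_ h₂
    · intro ψ; exact griffiths_signFunction s hJ χ φ ψ
    · simp
    · intro f g hf hg
      simpa [mul_add, add_mul, Finset.sum_add_distrib] using
        add_le_add hf hg
    · intro c f hf
      simp only [Pi.smul_apply, smul_mul_assoc, mul_smul_comm, ← Finset.smul_sum]
      exact smul_le_smul_of_nonneg_left hf c.2
  · simp
  · intro f g hf hg
    simpa [add_mul, Finset.sum_add_distrib] using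
      add_le_add hf hg
  · intro c f hf
    simp only [Pi.smul_apply, smul_mul_assoc, ← Finset.smul_sum]
    exact smul_le_smul_of_nonneg_left hf c.2

end PositiveType

/-! ### The Simon–Lieb inequality -/

section SimonLieb

variable {S : Type*}

/-- The spin at the site `x`, as a character of the group of configurations. -/
def spinChar (x : S) : (S → ℤˣ) →* ℤˣ := Pi.evalMonoidHom _ x

@[simp] lemma spinChar_apply (x : S) (g : S → ℤˣ) : spinChar x g = g x := rfl

lemma prod_one_add_sub_one_mem {R B : Type*} [CommRing R] (P : Subsemiring R) (E : Finset B)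
    {z : B → R} (hz : ∀ e ∈ E, z e ∈ P) : ∏ e ∈ E, (1 + z e) - 1 ∈ P := by
  classical
  induction E using Finset.induction_on with
  | empty => simp
  | insert a E ha ih =>
    rw [Finset.prod_insert ha]
    have h1 := ih fun e he => hz e (Finset.mem_insert_of_mem he)
    have h2 := hz a (Finset.mem_insert_self a E)
    have : (1 + z a) * ∏ e ∈ E, (1 + z e) - 1 =
      (1 + z a) * (∏ e ∈ E, (1 + z e) - 1) + z a := by ring
    rw [this]
    exact add_mem (mul_mem (add_mem (one_mem _) h2) h1) h2

/-- This is `∏ (1 + z) - 1 ≤ (∑ z) ∏ (1 + z)` for the order whose positive elements are `P`. A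
pointwise inequality would be of no use, because it is later multiplied by a function of varying
sign that lies in `P`. -/
lemma sum_sub_one_mul_prod_add_one_mem {R B : Type*} [CommRing R] (P : Subsemiring R)
    (E : Finset B) {z : B → R} (hz : ∀ e ∈ E, z e ∈ P) :
    (∑ e ∈ E, z e - 1) * ∏ e ∈ E, (1 + z e) + 1 ∈ P := by
  classical
  induction E using Finset.induction_on with
  | empty => simp
  | insert a E ha ih =>
    rw [Finset.prod_insert ha, Finset.sum_insert ha]
    have hz' : ∀ e ∈ E, z e ∈ P := fun e he => hz e (Finset.mem_insert_of_mem he)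
    have h1 := ih hz'
    have h2 := hz a (Finset.mem_insert_self a E)
    have h3 := prod_one_add_sub_one_mem P E hz'
    have h4 : ∏ e ∈ E, (1 + z e) ∈ P := prod_mem fun e he => add_mem (one_mem _) (hz' e he)
    have : (z a + ∑ e ∈ E, z e - 1) * ((1 + z a) * ∏ e ∈ E, (1 + z e)) + 1 =
      (1 + z a) * ((∑ e ∈ E, z e - 1) * ∏ e ∈ E, (1 + z e) + 1) +
        z a * (∏ e ∈ E, (1 + z e)) * z a + z a * (∏ e ∈ E, (1 + z e) - 1) := by ring
    rw [this]
    exact add_mem (add_mem (mul_mem (add_mem (one_mem _) h2) h1) (mul_mem (mul_mem h2 h4) h2))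
      (mul_mem h2 h3)

variable {ι : Type*} (p q : ι → S)

/-- The sign `g_{p i} g_{q i}` of a bond. -/
def bondSign (i : ι) (g : S → ℤˣ) : ℝ := ((g (p i) * g (q i) : ℤˣ) : ℤ)

lemma bondSign_eq (i : ι) :
    bondSign p q i = signFunction _ (spinChar (p i) * spinChar (q i)) := by
  ext g; simp [bondSign]

/-- The indicator function of the configurations that are constant on every bond of `F`. -/
noncomputable def agreement (F : Finset ι) (k : S → ℤˣ) : ℝ :=
  ∏ i ∈ F, (1 / 2) * (1 + bondSign p q i k)

/-- The weight of a bond set in the expansion of the doubled Gibbs weight. -/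
noncomputable def doubledWeight (J : ι → ℝ) (F : Finset ι) (g : S → ℤˣ) : ℝ :=
  ∏ i ∈ F, ((Real.cosh (2 * J i) - 1) + Real.sinh (2 * J i) * bondSign p q i g)

/-- The Gibbs weight of a pair interaction. -/
noncomputable def pairWeight (J : ι → ℝ) (I : Finset ι) (g : S → ℤˣ) : ℝ :=
  Real.exp (∑ i ∈ I, J i * bondSign p q i g)

/-- With `β`, `κ` the signs of a bond under `g` and `k`, the bond contributes `exp (J β (1 + κ)) = 1
+ (1 + κ) / 2 * (exp (2 J β) - 1)`, and `exp (2 J β) = cosh (2 J) + sinh (2 J) * β`. Expanding the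
product over bonds yields the sum over bond sets. -/
lemma pairWeight_mul_pairWeight (J : ι → ℝ) (I : Finset ι) (g k : S → ℤˣ) :
    pairWeight p q J I g * pairWeight p q J I (g * k) =
      ∑ F ∈ I.powerset, agreement p q F k * doubledWeight p q J F g := by
  simp only [agreement, doubledWeight, ← Finset.prod_mul_distrib]
  rw [← Finset.prod_one_add, pairWeight, pairWeight, ← Real.exp_add, ← Finset.sum_add_distrib,
    Real.exp_sum]
  refine Finset.prod_congr rfl fun i _ => ?_
  have h : bondSign p q i (g * k) = bondSign p q i g * bondSign p q i k := by
    simp [bondSign]; ring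
  rw [h]
  rcases Int.units_eq_one_or (g (p i) * g (q i)) with h1 | h1 <;>
  rcases Int.units_eq_one_or (k (p i) * k (q i)) with h2 | h2 <;>
  simp only [bondSign, h1, h2, Real.cosh_eq, Real.sinh_eq] <;> norm_num <;> ring_nf

lemma agreement_mem (F : Finset ι) : agreement p q F ∈ positiveType (S → ℤˣ) := by
  have : agreement p q F = ∏ i ∈ F, fun k => (1 / 2) * (1 + bondSign p q i k) := by
    ext k; simp [agreement]
  rw [this]
  refine prod_mem fun i _ => smul_mem_positiveType (add_mem (one_mem _) ?_) (by norm_num)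
  rw [bondSign_eq]; exact signFunction_mem _

lemma doubledWeight_mem {J : ι → ℝ} (F : Finset ι) (hJ : ∀ i ∈ F, 0 ≤ J i) :
    doubledWeight p q J F ∈ positiveType (S → ℤˣ) := by
  have : doubledWeight p q J F = ∏ i ∈ F, ((fun _ => Real.cosh (2 * J i) - 1) +
      fun g => Real.sinh (2 * J i) * bondSign p q i g) := by
    ext k; simp [doubledWeight]
  rw [this]
  refine prod_mem fun i hi => add_mem (const_mem_positiveType ?_) (smul_mem_positiveType ?_ ?_)
  · linarith [Real.one_le_cosh (2 * J i)]
  · rw [bondSign_eq]; exact signFunction_mem _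
  · exact Real.sinh_nonneg_iff.2 (mul_nonneg (by norm_num) (hJ i hi))

variable {B G : Type*} [CommGroup G] (b : B → S) (γ : B → G →* ℤˣ)

/-- The sign of a bond that joins a site of `S` to the exterior. -/
def crossSign (e : B) (x : (S → ℤˣ) × G) : ℝ := ((x.1 (b e) * γ e x.2 : ℤˣ) : ℤ)

lemma crossSign_mem (e : B) : crossSign b γ e ∈ positiveType ((S → ℤˣ) × G) := by
  have : crossSign b γ e = signFunction _ ((spinChar (b e)).comp (MonoidHom.fst _ _) *
    (γ e).comp (MonoidHom.snd _ _)) := by ext; simp [crossSign]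
  rw [this]; exact signFunction_mem _

/-- The sites whose spin agrees with the spin at `o` whenever all bonds of `F` agree. -/
def cluster (F : Finset ι) (o : S) : Set S :=
  {x | ∀ k : S → ℤˣ, (∀ i ∈ F, k (p i) * k (q i) = 1) → k o * k x = 1}

variable {p q} in
lemma agreement_of_not_forall {F : Finset ι} {k : S → ℤˣ}
    (h : ¬ ∀ i ∈ F, k (p i) * k (q i) = 1) : agreement p q F k = 0 := by
  push Not at h
  obtain ⟨i, hi, h⟩ := h
  refine Finset.prod_eq_zero hi ?_
  rw [bondSign, (Int.units_eq_one_or _).resolve_left h]; norm_num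

variable [Fintype S] [DecidableEq S] [Fintype G]

open Classical in
-- Flipping the spins of the cluster of `o` preserves the sign of every bond of `F` and of every
-- exterior bond in `E`, but reverses the spin at `o`.
lemma sum_flip_eq_zero (J : ι → ℝ) (F : Finset ι) (o : S) (E : Finset B) (t : B → ℝ)
    (hE : ∀ e ∈ E, b e ∉ cluster p q F o) (v : G → ℝ) :
    ∑ x : (S → ℤˣ) × G, ((x.1 o : ℤ) : ℝ) * doubledWeight p q J F x.1 * v x.2 *
      ∏ e ∈ E, (1 + t e * crossSign b γ e x) = 0 := by
  set C := cluster p q F o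
  let k : S → ℤˣ := fun x => if x ∈ C then -1 else 1
  have ho : k o = -1 := if_pos fun k _ => Int.units_mul_self _
  have hb : ∀ e ∈ E, k (b e) = 1 := fun e he => if_neg (hE e he)
  have hF : ∀ i ∈ F, k (p i) * k (q i) = 1 := by
    intro i hi
    have : p i ∈ C ↔ q i ∈ C := by
      refine forall_congr' fun k => forall_congr' fun hk => ?_
      have h1 := hk i hi
      have : k (p i) = k (q i) := by
        rw [mul_eq_one_iff_eq_inv] at h1; rw [h1, Int.units_inv_eq_self]
      rw [this]
    by_cases h : q i ∈ C <;> simp [k, this, h]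
  have hD : ∀ g, doubledWeight p q J F (k * g) = doubledWeight p q J F g := fun g => by
    refine Finset.prod_congr rfl fun i hi => ?_
    have : bondSign p q i (k * g) = bondSign p q i g := by
      simp only [bondSign, Pi.mul_apply]
      rw [mul_mul_mul_comm, hF i hi, one_mul]
    rw [this]
  have key : ∀ f : (S → ℤˣ) × G → ℝ, (∀ x, f ((k, 1) * x) = -f x) → ∑ x, f x = 0 := by
    intro f hf
    have h := Equiv.sum_comp (Equiv.mulLeft ((k, 1) : (S → ℤˣ) × G)) f
    simp only [Equiv.coe_mulLeft, hf, Finset.sum_neg_distrib] at h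
    linarith
  refine key _ fun x => ?_
  have hP : ∏ e ∈ E, (1 + t e * crossSign b γ e ((k, 1) * x)) =
      ∏ e ∈ E, (1 + t e * crossSign b γ e x) := by
    refine Finset.prod_congr rfl fun e he => ?_
    simp [crossSign, hb e he]
  rw [hP]
  simp [hD, ho]

/-- For a fixed bond set `F`, only exterior bonds attached to the cluster of `o` can transmit
correlation. At these the spin agrees with the spin at `o` on the support of `agreement`, which
turns the normalising sum on the left into the correlation on the right. -/
lemma simonLieb_bondSet {J : ι → ℝ} (F : Finset ι) (hJ : ∀ i ∈ F, 0 ≤ J i) (o : S) (E : Finset B)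
    {t : B → ℝ} (ht : ∀ e ∈ E, 0 ≤ t e) {v : G → ℝ} (hv : v ∈ positiveType G) :
    (∑ k, agreement p q F k) * (∑ x : (S → ℤˣ) × G, ((x.1 o : ℤ) : ℝ) * doubledWeight p q J F x.1 *
        v x.2 * ∏ e ∈ E, (1 + t e * crossSign b γ e x)) ≤
      ∑ e ∈ E, (∑ k, ((k o * k (b e) : ℤˣ) : ℤ) * agreement p q F k) *
        (∑ x : (S → ℤˣ) × G, ((x.1 o : ℤ) : ℝ) * doubledWeight p q J F x.1 * v x.2 *
          (t e * crossSign b γ e x) * ∏ e ∈ E, (1 + t e * crossSign b γ e x)) := by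
  classical
  set P := positiveType ((S → ℤˣ) × G)
  set z : B → (S → ℤˣ) × G → ℝ := fun e x => t e * crossSign b γ e x with hz_def
  set a : (S → ℤˣ) × G → ℝ := fun x =>
    ((x.1 o : ℤ) : ℝ) * doubledWeight p q J F x.1 * v x.2 with ha_def
  have hz : ∀ e ∈ E, z e ∈ P := fun e he => smul_mem_positiveType (crossSign_mem b γ e) (ht e he)
  have ha : a ∈ P := by
    refine mul_mem (mul_mem ?_ ?_) ?_
    · exact comp_mem_positiveType (signFunction_mem (spinChar o)) (MonoidHom.fst (S → ℤˣ) G)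
    · exact comp_mem_positiveType (doubledWeight_mem p q F hJ) (MonoidHom.fst (S → ℤˣ) G)
    · exact comp_mem_positiveType hv (MonoidHom.snd (S → ℤˣ) G)
  have hprod : ∀ (E : Finset B) x, ∏ e ∈ E, (1 + z e x) = (∏ e ∈ E, (1 + z e)) x := fun E x => by
    simp [Finset.prod_apply]
  have hM : ∏ e ∈ E, (1 + z e) ∈ P := prod_mem fun e he => add_mem (one_mem _) (hz e he)
  set E₁ := E.filter fun e => b e ∈ cluster p q F o with hE₁
  set E₂ := E.filter fun e => b e ∉ cluster p q F o with hE₂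
  have hsplit : ∏ e ∈ E, (1 + z e) = (∏ e ∈ E₁, (1 + z e)) * ∏ e ∈ E₂, (1 + z e) :=
    (Finset.prod_filter_mul_prod_filter_not _ _ _).symm
  have hcorr : ∀ e, 0 ≤ ∑ k, (((k o * k (b e) : ℤˣ) : ℤ) : ℝ) * agreement p q F k := fun e =>
    sum_nonneg_of_mem_positiveType (mul_mem (signFunction_mem (spinChar o * spinChar (b e)))
      (agreement_mem p q F))
  have hcorr₁ : ∀ e ∈ E₁, ∑ k, (((k o * k (b e) : ℤˣ) : ℤ) : ℝ) * agreement p q F k =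
      ∑ k, agreement p q F k := fun e he => by
    refine Finset.sum_congr rfl fun k _ => ?_
    by_cases hk : ∀ i ∈ F, k (p i) * k (q i) = 1
    · rw [(Finset.mem_filter.1 he).2 k hk]; simp
    · rw [agreement_of_not_forall hk, mul_zero]
  have hpos : ∀ e ∈ E, 0 ≤ ∑ x, a x * z e x * ∏ e ∈ E, (1 + z e x) := fun e he => by
    simp only [hprod]
    exact sum_nonneg_of_mem_positiveType (mul_mem (mul_mem ha (hz e he)) hM)
  -- Without the factors of `E₁` the sum vanishes by the flip, so `∏ (1 + z)` over `E₁` may be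
  -- replaced by itself minus `1` and bounded by `(∑ z) ∏ (1 + z)`.
  have hmain : ∑ x, a x * ∏ e ∈ E, (1 + z e x) ≤
      ∑ e ∈ E₁, ∑ x, a x * z e x * ∏ e ∈ E, (1 + z e x) := by
    have h0 : ∑ x, a x * ∏ e ∈ E₂, (1 + z e x) = 0 :=
      sum_flip_eq_zero p q b γ J F o E₂ t (fun e he => (Finset.mem_filter.1 he).2) v
    have hz₁ : ∀ e ∈ E₁, z e ∈ P := fun e he => hz e (Finset.mem_filter.1 he).1
    have h1 : a * ((∏ e ∈ E₂, (1 + z e)) *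
        ((∑ e ∈ E₁, z e - 1) * ∏ e ∈ E₁, (1 + z e) + 1)) ∈ P := by
      refine mul_mem ha (mul_mem ?_ ?_)
      · exact prod_mem fun e he => add_mem (one_mem _) (hz e (Finset.mem_filter.1 he).1)
      · exact sum_sub_one_mul_prod_add_one_mem P.toSubsemiring E₁ hz₁
    have h2 := sum_nonneg_of_mem_positiveType h1
    have h3 : a * ((∏ e ∈ E₂, (1 + z e)) *
        ((∑ e ∈ E₁, z e - 1) * ∏ e ∈ E₁, (1 + z e) + 1)) =
        (∑ e ∈ E₁, a * z e * ∏ e ∈ E, (1 + z e)) - a * ∏ e ∈ E, (1 + z e) +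
          a * ∏ e ∈ E₂, (1 + z e) := by
      rw [← Finset.sum_mul, ← Finset.mul_sum, hsplit]; ring
    rw [h3] at h2
    simp only [Pi.add_apply, Pi.sub_apply, Finset.sum_apply, Pi.mul_apply,
      Finset.sum_add_distrib, Finset.sum_sub_distrib, ← hprod] at h2
    rw [h0, Finset.sum_comm] at h2
    linarith
  calc _ ≤ (∑ k, agreement p q F k) * ∑ e ∈ E₁, ∑ x, a x * z e x * ∏ e ∈ E, (1 + z e x) :=
        mul_le_mul_of_nonneg_left hmain (sum_nonneg_of_mem_positiveType (agreement_mem p q F))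
    _ = ∑ e ∈ E₁, (∑ k, (((k o * k (b e) : ℤˣ) : ℤ) : ℝ) * agreement p q F k) *
          ∑ x, a x * z e x * ∏ e ∈ E, (1 + z e x) := by
        rw [Finset.mul_sum]
        exact Finset.sum_congr rfl fun e he => by rw [hcorr₁ e he]
    _ ≤ _ := Finset.sum_le_sum_of_subset_of_nonneg (Finset.filter_subset _ _) fun e he _ =>
        mul_nonneg (hcorr e) (hpos e he)

/-- The Simon–Lieb inequality. The spins of `S` interact by pairs among themselves and with the
exterior configurations `G`, and `v` is the exterior weight. -/
lemma simonLieb {J : ι → ℝ} (I : Finset ι) (hJ : ∀ i ∈ I, 0 ≤ J i) (o : S) (E : Finset B)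
    {t : B → ℝ} (ht : ∀ e ∈ E, 0 ≤ t e) {v : G → ℝ} (hv : v ∈ positiveType G) :
    (∑ x : (S → ℤˣ) × G, ((x.1 o : ℤ) : ℝ) * (pairWeight p q J I x.1 *
        (∏ e ∈ E, (1 + t e * crossSign b γ e x)) * v x.2)) * (∑ g, pairWeight p q J I g) ≤
      ∑ e ∈ E, t e * (∑ g, ((g o : ℤ) : ℝ) * ((g (b e) : ℤ) : ℝ) * pairWeight p q J I g) *
        ∑ x : (S → ℤˣ) × G, ((γ e x.2 : ℤ) : ℝ) * (pairWeight p q J I x.1 *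
          (∏ e ∈ E, (1 + t e * crossSign b γ e x)) * v x.2) := by
  set u := pairWeight p q J I
  set M : (S → ℤˣ) × G → ℝ := fun x => ∏ e ∈ E, (1 + t e * crossSign b γ e x)
  -- The second copy is reparametrised as `g * k`. Multiplicativity of `r` separates `g` from `k`,
  -- and both sides of the claim become sums over the same bond sets: `r = 1` on the left, `r = g_o
  -- g_{b e}` on the right.
  have key : ∀ (f : (S → ℤˣ) × G → ℝ) (r : (S → ℤˣ) → ℝ),
      (∀ g k, r (g * k) = r g * r k) →
      (∑ x, f x * u x.1) * (∑ g, r g * u g) =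
        ∑ F ∈ I.powerset, (∑ k, r k * agreement p q F k) *
          ∑ x, f x * r x.1 * doubledWeight p q J F x.1 := by
    intro f r hr
    calc (∑ x, f x * u x.1) * (∑ g, r g * u g)
        = ∑ x, ∑ k, f x * u x.1 * (r (x.1 * k) * u (x.1 * k)) := by
          rw [Finset.sum_mul_sum]
          exact Finset.sum_congr rfl fun x _ =>
            (Equiv.sum_comp (Equiv.mulLeft x.1) (fun g => f x * u x.1 * (r g * u g))).symm
      _ = ∑ x, ∑ k, ∑ F ∈ I.powerset, (r k * agreement p q F k) *
            (f x * r x.1 * doubledWeight p q J F x.1) := by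
          refine Finset.sum_congr rfl fun x _ => Finset.sum_congr rfl fun k _ => ?_
          have : f x * u x.1 * (r (x.1 * k) * u (x.1 * k)) =
            f x * r x.1 * r k * (u x.1 * u (x.1 * k)) := by rw [hr]; ring
          rw [this, pairWeight_mul_pairWeight, Finset.mul_sum]
          exact Finset.sum_congr rfl fun F _ => by ring
      _ = _ := by
          simp only [Finset.sum_mul_sum]
          rw [Finset.sum_comm' (s := Finset.univ) (t := fun _ => Finset.univ)
            (s' := fun _ => Finset.univ) (t' := Finset.univ) (by simp)]
          rw [Finset.sum_comm' (s := I.powerset) (t := fun _ => Finset.univ)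
            (s' := fun _ => I.powerset) (t' := Finset.univ) (by simp)]
          refine Finset.sum_congr rfl fun k _ => ?_
          rw [Finset.sum_comm]
  have hL := key (fun x => ((x.1 o : ℤ) : ℝ) * v x.2 * M x) (fun _ => 1) (by simp)
  have hR : ∀ e, _ := fun e => key (fun x => ((γ e x.2 : ℤ) : ℝ) * v x.2 * M x)
    (fun g => ((g o : ℤ) : ℝ) * ((g (b e) : ℤ) : ℝ)) (fun g k => by simp; ring)
  calc _ = (∑ x : (S → ℤˣ) × G, ((x.1 o : ℤ) : ℝ) * v x.2 * M x * u x.1) * (∑ g, 1 * u g) := by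
        congr 1
        · exact Finset.sum_congr rfl fun x _ => by ring
        · simp
    _ ≤ ∑ e ∈ E, t e * ((∑ x : (S → ℤˣ) × G, ((γ e x.2 : ℤ) : ℝ) * v x.2 * M x * u x.1) *
          ∑ g, ((g o : ℤ) : ℝ) * ((g (b e) : ℤ) : ℝ) * u g) := by
        simp only [hL, hR, Finset.mul_sum (s := I.powerset)]
        rw [Finset.sum_comm]
        refine Finset.sum_le_sum fun F hF => ?_
        refine (le_of_eq ?_).trans ((simonLieb_bondSet p q b γ F
          (fun i hi => hJ i (Finset.mem_powerset.1 hF hi)) o E ht hv).trans (le_of_eq ?_))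
        · simp only [one_mul, mul_one]
          congr 1
          exact Finset.sum_congr rfl fun x _ => by simp only [M]; ring
        · refine Finset.sum_congr rfl fun e _ => ?_
          rw [mul_left_comm (t e)]
          congr 1
          · exact Finset.sum_congr rfl fun k _ => by simp
          · rw [Finset.mul_sum]
            refine Finset.sum_congr rfl fun x _ => ?_
            simp only [crossSign, Units.val_mul, Int.cast_mul, M]
            ring
    _ = _ := by
        refine Finset.sum_congr rfl fun e _ => ?_
        rw [mul_assoc, mul_comm (∑ x : (S → ℤˣ) × G, _)]
        congr 2
        exact Finset.sum_congr rfl fun x _ => by ring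

end SimonLieb

/-! ### Free states in finite volume and their monotonicity -/

variable {ν : ℕ}

lemma neighbours_comm {x y : Site ν} : y ∈ neighbours x ↔ x ∈ neighbours y := by
  simp only [neighbours, Finset.mem_filter, Finset.mem_Icc, Pi.le_def, Pi.sub_apply, Pi.add_apply,
    Pi.one_apply]
  have : ∑ i, (x i - y i) ^ 2 = ∑ i, (y i - x i) ^ 2 :=
    Finset.sum_congr rfl fun i _ => by ring
  rw [this]
  refine and_congr_left fun _ => ⟨fun h => ⟨fun i => ?_, fun i => ?_⟩,
    fun h => ⟨fun i => ?_, fun i => ?_⟩⟩ <;> [have := h.2 i; have := h.1 i; have := h.2 i;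
      have := h.1 i] <;> omega

/-- The ordered nearest-neighbour pairs of `Λ`. -/
noncomputable def pairs (Λ : Finset (Site ν)) : Finset (Site ν × Site ν) :=
  (Λ ×ˢ Λ).filter fun p => p.2 ∈ neighbours p.1

lemma mem_pairs {Λ : Finset (Site ν)} {p : Site ν × Site ν} :
    p ∈ pairs Λ ↔ p.1 ∈ Λ ∧ p.2 ∈ Λ ∧ p.2 ∈ neighbours p.1 := by
  simp [pairs, and_assoc]

lemma sum_pairs (Λ : Finset (Site ν)) (f : Site ν → Site ν → ℝ) :
    ∑ p ∈ pairs Λ, f p.1 p.2 = ∑ x ∈ Λ, ∑ y ∈ neighbours x ∩ Λ, f x y := by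
  rw [pairs, Finset.sum_filter, Finset.sum_product]
  refine Finset.sum_congr rfl fun x _ => ?_
  rw [← Finset.sum_filter]
  refine Finset.sum_congr ?_ fun _ _ => rfl
  ext y; simp [and_comm]

lemma pairs_mono {Λ Λ' : Finset (Site ν)} (h : Λ ⊆ Λ') : pairs Λ ⊆ pairs Λ' := fun p hp => by
  rw [mem_pairs] at hp ⊢
  exact ⟨h hp.1, h hp.2.1, hp.2.2⟩

/-- The spin at `x`, as a character of the configurations on `Λ`; it is trivial outside `Λ`. -/
def siteChar (Λ : Finset (Site ν)) (x : Site ν) : (Λ → ℤˣ) →* ℤˣ :=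
  if h : x ∈ Λ then spinChar ⟨x, h⟩ else 1

lemma extend_one (Λ : Finset (Site ν)) (σ : Λ → ℤˣ) (x : Site ν) :
    extend Λ 1 σ x = signFunction _ (siteChar Λ x) σ := by
  by_cases h : x ∈ Λ <;> simp [extend, siteChar, h]

lemma extend_zero {Λ : Finset (Site ν)} (σ : Λ → ℤˣ) {x : Site ν} (h : x ∈ Λ) :
    extend Λ 0 σ x = signFunction _ (siteChar Λ x) σ := by
  simp [extend, siteChar, h]

lemma neg_energy_zero_div (J T : ℝ) (Λ : Finset (Site ν)) (σ : Λ → ℤˣ) :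
    -energy J Λ 0 σ / T = ∑ p ∈ pairs Λ,
      J / T / 2 * signFunction _ (siteChar Λ p.1 * siteChar Λ p.2) σ := by
  have h0 : ∑ x ∈ Λ, ∑ y ∈ neighbours x \ Λ, extend Λ 0 σ x * extend Λ 0 σ y = 0 :=
    Finset.sum_eq_zero fun x _ => Finset.sum_eq_zero fun y hy => by
      simp [extend, (Finset.mem_sdiff.1 hy).2]
  rw [energy, h0, ← sum_pairs Λ fun x y => extend Λ 0 σ x * extend Λ 0 σ y, add_zero,
    ← Finset.mul_sum]
  have : ∀ p ∈ pairs Λ, extend Λ 0 σ p.1 * extend Λ 0 σ p.2 =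
      signFunction _ (siteChar Λ p.1 * siteChar Λ p.2) σ := fun p hp => by
    rw [mem_pairs] at hp
    rw [extend_zero σ hp.1, extend_zero σ hp.2.1, map_mul, Pi.mul_apply]
  rw [Finset.sum_congr rfl this]
  ring

lemma prod_extend_zero {Λ A : Finset (Site ν)} (hA : A ⊆ Λ) (σ : Λ → ℤˣ) :
    ∏ x ∈ A, extend Λ 0 σ x = signFunction _ (∏ x ∈ A, siteChar Λ x) σ := by
  rw [map_prod, Finset.prod_apply]
  exact Finset.prod_congr rfl fun x hx => extend_zero σ (hA hx)

/-- A configuration on `Λ` is a pair of configurations on `S` and on `Λ \ S`. -/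
def splitEquiv {S Λ : Finset (Site ν)} (h : S ⊆ Λ) :
    (Λ → ℤˣ) ≃ (S → ℤˣ) × (↥(Λ \ S) → ℤˣ) where
  toFun σ := (fun x => σ ⟨x, h x.2⟩, fun x => σ ⟨x, (Finset.mem_sdiff.1 x.2).1⟩)
  invFun τ x := if hx : (x : Site ν) ∈ S then τ.1 ⟨x, hx⟩ else
    τ.2 ⟨x, Finset.mem_sdiff.2 ⟨x.2, hx⟩⟩
  left_inv σ := by ext x; by_cases hx : (x : Site ν) ∈ S <;> simp [hx]
  right_inv τ := by
    ext x
    · simp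
    · simp [(Finset.mem_sdiff.1 x.2).2]

section

variable {S Λ : Finset (Site ν)} (h : S ⊆ Λ)

lemma siteChar_split_fst {x : Site ν} (hx : x ∈ S) (σ : Λ → ℤˣ) :
    siteChar S x (splitEquiv h σ).1 = siteChar Λ x σ := by
  simp [siteChar, hx, h hx, splitEquiv]

lemma siteChar_split_snd {x : Site ν} (hx : x ∉ S) (σ : Λ → ℤˣ) :
    siteChar (Λ \ S) x (splitEquiv h σ).2 = siteChar Λ x σ := by
  by_cases hΛ : x ∈ Λ <;> simp [siteChar, hx, hΛ, splitEquiv]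

lemma sum_split_fst (F : (S → ℤˣ) → ℝ) :
    ∑ σ : Λ → ℤˣ, F (splitEquiv h σ).1 = Fintype.card (↥(Λ \ S) → ℤˣ) * ∑ τ, F τ := by
  rw [Equiv.sum_comp (splitEquiv h) fun τ => F τ.1, Fintype.sum_prod_type]
  simp only [Finset.sum_const, Finset.card_univ, nsmul_eq_mul, Finset.mul_sum]

end

lemma sum_exp_pos {ι : Type*} [Fintype ι] [Nonempty ι] (f : ι → ℝ) : 0 < ∑ i, Real.exp (f i) :=
  Finset.sum_pos (fun _ _ => Real.exp_pos _) Finset.univ_nonempty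

/-- The free state on `S`, as a state of the larger volume `Λ` without the other bonds. -/
lemma gibbs_prod_eq_of_subset (J T : ℝ) {A S Λ : Finset (Site ν)} (hA : A ⊆ S) (h : S ⊆ Λ) :
    gibbs J T S 0 (fun s => ∏ x ∈ A, s x) =
      (∑ σ : Λ → ℤˣ, signFunction _ (∏ x ∈ A, siteChar Λ x) σ * Real.exp (∑ p ∈ pairs S,
        J / T / 2 * signFunction _ (siteChar Λ p.1 * siteChar Λ p.2) σ)) /
      ∑ σ : Λ → ℤˣ, Real.exp (∑ p ∈ pairs S,
        J / T / 2 * signFunction _ (siteChar Λ p.1 * siteChar Λ p.2) σ) := by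
  have hw : ∀ σ : Λ → ℤˣ, Real.exp (∑ p ∈ pairs S,
      J / T / 2 * signFunction _ (siteChar Λ p.1 * siteChar Λ p.2) σ) =
      Real.exp (-energy J S 0 (splitEquiv h σ).1 / T) := fun σ => by
    rw [neg_energy_zero_div]
    refine congrArg _ (Finset.sum_congr rfl fun p hp => ?_)
    rw [mem_pairs] at hp
    simp only [signFunction_apply, MonoidHom.mul_apply, siteChar_split_fst h hp.1,
      siteChar_split_fst h hp.2.1]
  have hf : ∀ σ, signFunction _ (∏ x ∈ A, siteChar Λ x) σ =
      ∏ x ∈ A, extend S 0 (splitEquiv h σ).1 x := fun σ => by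
    rw [map_prod, Finset.prod_apply]
    refine Finset.prod_congr rfl fun x hx => ?_
    rw [extend_zero _ (hA hx), signFunction_apply, signFunction_apply,
      siteChar_split_fst h (hA hx)]
  rw [Finset.sum_congr rfl fun σ _ => congrArg₂ (· * ·) (hf σ) (hw σ),
    Finset.sum_congr rfl fun σ _ => hw σ,
    sum_split_fst h fun τ => (∏ x ∈ A, extend S 0 τ x) * Real.exp (-energy J S 0 τ / T),
    sum_split_fst h fun τ => Real.exp (-energy J S 0 τ / T), gibbs,
    mul_div_mul_left _ _ (Nat.cast_ne_zero.2 Fintype.card_ne_zero)]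

/-- The free expectations of spin products increase with the volume. -/
lemma gibbs_prod_mono {J T : ℝ} (hK : 0 ≤ J / T) {A S Λ : Finset (Site ν)} (hA : A ⊆ S)
    (h : S ⊆ Λ) : gibbs J T S 0 (fun s => ∏ x ∈ A, s x) ≤ gibbs J T Λ 0 fun s => ∏ x ∈ A, s x := by
  set χ : Site ν × Site ν → (Λ → ℤˣ) →* ℤˣ := fun p => siteChar Λ p.1 * siteChar Λ p.2
  set w : (Λ → ℤˣ) → ℝ := fun σ => Real.exp (∑ p ∈ pairs S, J / T / 2 * signFunction _ (χ p) σ)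
    with hw
  set f₁ : (Λ → ℤˣ) → ℝ := signFunction _ (∏ x ∈ A, siteChar Λ x) with hf₁
  -- The Boltzmann factor of the added bonds is of positive type, so inserting it can only increase
  -- the expectation, by Griffiths' second inequality.
  set f₂ : (Λ → ℤˣ) → ℝ := fun σ => Real.exp (∑ p ∈ pairs Λ \ pairs S,
    J / T / 2 * signFunction _ (χ p) σ)
  have hR : gibbs J T Λ 0 (fun s => ∏ x ∈ A, s x) = (∑ σ, f₁ σ * f₂ σ * w σ) / ∑ σ, f₂ σ * w σ := by
    have hw' : ∀ σ, Real.exp (-energy J Λ 0 σ / T) = f₂ σ * w σ := fun σ => by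
      rw [neg_energy_zero_div, ← Real.exp_add, Finset.sum_sdiff (pairs_mono h)]
    simp only [gibbs, hw', prod_extend_zero (hA.trans h), mul_assoc, hf₁]
  rw [gibbs_prod_eq_of_subset J T hA h, hR, div_le_div_iff₀ (sum_exp_pos _)]
  · exact griffiths _ (fun _ _ => div_nonneg hK zero_le_two) χ (signFunction_mem _)
      (exp_mem_positiveType _ (fun _ _ => div_nonneg hK zero_le_two) χ)
  · exact Finset.sum_pos (fun σ _ => mul_pos (Real.exp_pos _) (Real.exp_pos _)) Finset.univ_nonempty

lemma gibbs_prod_nonneg {J T : ℝ} (hK : 0 ≤ J / T) {A Λ : Finset (Site ν)} (hA : A ⊆ Λ) :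
    0 ≤ gibbs J T Λ 0 fun s => ∏ x ∈ A, s x := by
  refine div_nonneg ?_ (sum_exp_pos _).le
  simp only [prod_extend_zero hA, neg_energy_zero_div]
  exact sum_nonneg_of_mem_positiveType (mul_mem (signFunction_mem _)
    (exp_mem_positiveType _ (fun _ _ => div_nonneg hK zero_le_two) _))

lemma abs_extend_le {Λ : Finset (Site ν)} {b : ℝ} (hb : |b| ≤ 1) (σ : Λ → ℤˣ) (x : Site ν) :
    |extend Λ b σ x| ≤ 1 := by
  unfold extend
  split_ifs with h
  · rcases Int.units_eq_one_or (σ ⟨x, h⟩) with h | h <;> simp [h]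
  · exact hb

lemma gibbs_le_one {J T : ℝ} {Λ : Finset (Site ν)} {b : ℝ} {g : (Site ν → ℝ) → ℝ}
    (hg : ∀ σ, g (extend Λ b σ) ≤ 1) : gibbs J T Λ b g ≤ 1 := by
  refine div_le_one_of_le₀ (Finset.sum_le_sum fun σ _ => ?_) (sum_exp_pos _).le
  simpa using mul_le_mul_of_nonneg_right (hg σ) (Real.exp_pos (-energy J Λ b σ / T)).le

/-! ### Translations -/

/-- The translate `Λ + a`. -/
def translate (a : Site ν) (Λ : Finset (Site ν)) : Finset (Site ν) := Λ.map (addRightEmbedding a)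

lemma mem_translate {a x : Site ν} {Λ : Finset (Site ν)} : x ∈ translate a Λ ↔ x - a ∈ Λ := by
  simp only [translate, Finset.mem_map, addRightEmbedding_apply]
  exact ⟨fun ⟨y, hy, h⟩ => by rwa [← h, add_sub_cancel_right], fun h => ⟨_, h, sub_add_cancel _ _⟩⟩

lemma neighbours_add (x a : Site ν) : neighbours (x + a) = translate a (neighbours x) := by
  ext y
  simp only [mem_translate, neighbours, Finset.mem_filter, Finset.mem_Icc, Pi.le_def, Pi.sub_apply,
    Pi.add_apply, Pi.one_apply]
  refine and_congr (and_congr (forall_congr' fun i => ?_) (forall_congr' fun i => ?_)) ?_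
  · constructor <;> intro h <;> linarith
  · constructor <;> intro h <;> linarith
  · refine iff_of_eq (congrArg (· = 1) (Finset.sum_congr rfl fun i _ => by ring))

lemma translate_inter (a : Site ν) (Λ Λ' : Finset (Site ν)) :
    translate a Λ ∩ translate a Λ' = translate a (Λ ∩ Λ') := by ext; simp [mem_translate]

lemma translate_sdiff (a : Site ν) (Λ Λ' : Finset (Site ν)) :
    translate a Λ \ translate a Λ' = translate a (Λ \ Λ') := by ext; simp [mem_translate]

lemma sum_translate (a : Site ν) (Λ : Finset (Site ν)) (f : Site ν → ℝ) :
    ∑ x ∈ translate a Λ, f x = ∑ x ∈ Λ, f (x + a) := by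
  simp [translate]

/-- The translation of configurations. -/
def translateEquiv (a : Site ν) (Λ : Finset (Site ν)) :
    (↥(translate a Λ) → ℤˣ) ≃ (Λ → ℤˣ) where
  toFun σ x := σ ⟨x + a, mem_translate.2 (by simp)⟩
  invFun τ x := τ ⟨x - a, mem_translate.1 x.2⟩
  left_inv σ := by ext x; simp
  right_inv τ := by ext x; simp

lemma extend_translateEquiv (a : Site ν) (Λ : Finset (Site ν)) (b : ℝ)
    (σ : ↥(translate a Λ) → ℤˣ) (x : Site ν) :
    extend Λ b (translateEquiv a Λ σ) x = extend (translate a Λ) b σ (x + a) := by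
  by_cases h : x ∈ Λ <;> simp [extend, translateEquiv, mem_translate, h]

lemma energy_translateEquiv (J : ℝ) (a : Site ν) (Λ : Finset (Site ν)) (b : ℝ)
    (σ : ↥(translate a Λ) → ℤˣ) :
    energy J Λ b (translateEquiv a Λ σ) = energy J (translate a Λ) b σ := by
  simp only [energy, extend_translateEquiv, sum_translate, neighbours_add, translate_inter,
    translate_sdiff]

lemma gibbs_translate (J T : ℝ) (a : Site ν) (Λ : Finset (Site ν)) (b : ℝ)
    (g : (Site ν → ℝ) → ℝ) :
    gibbs J T (translate a Λ) b (fun s => g fun x => s (x + a)) = gibbs J T Λ b g := by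
  simp only [gibbs]
  rw [← Equiv.sum_comp (translateEquiv a Λ), ← Equiv.sum_comp (translateEquiv a Λ)
    fun σ => Real.exp (-energy J Λ b σ / T)]
  simp only [energy_translateEquiv, funext (extend_translateEquiv a Λ b _)]

/-! ### Simon–Lieb for the plus magnetisation -/

/-- Splitting the bond energy of `Λ` along `S`, when `Λ` contains the neighbours of `S`. -/
lemma bondSum_split {S Λ : Finset (Site ν)} (h : S ⊆ Λ) (hN : ∀ x ∈ S, neighbours x ⊆ Λ)
    (s : Site ν → ℝ) :
    (1 / 2) * ∑ x ∈ Λ, ∑ y ∈ neighbours x ∩ Λ, s x * s y +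
        ∑ x ∈ Λ, ∑ y ∈ neighbours x \ Λ, s x * s y =
      (1 / 2) * ∑ x ∈ S, ∑ y ∈ neighbours x ∩ S, s x * s y +
        ∑ x ∈ S, ∑ y ∈ neighbours x \ S, s x * s y +
        ((1 / 2) * ∑ x ∈ Λ \ S, ∑ y ∈ neighbours x ∩ (Λ \ S), s x * s y +
          ∑ x ∈ Λ \ S, ∑ y ∈ neighbours x \ Λ, s x * s y) := by
  rw [← Finset.sum_sdiff h, ← Finset.sum_sdiff h]
  have h1 : ∑ x ∈ S, ∑ y ∈ neighbours x \ Λ, s x * s y = 0 :=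
    Finset.sum_eq_zero fun x hx => by
      rw [Finset.sdiff_eq_empty_iff_subset.2 (hN x hx), Finset.sum_empty]
  have h2 : ∑ x ∈ S, ∑ y ∈ neighbours x ∩ Λ, s x * s y =
      ∑ x ∈ S, ∑ y ∈ neighbours x ∩ S, s x * s y +
        ∑ x ∈ S, ∑ y ∈ neighbours x \ S, s x * s y := by
    rw [← Finset.sum_add_distrib]
    refine Finset.sum_congr rfl fun x hx => ?_
    rw [Finset.inter_eq_left.2 (hN x hx), Finset.sum_inter_add_sum_sdiff]
  have h3 : ∑ x ∈ Λ \ S, ∑ y ∈ neighbours x ∩ Λ, s x * s y =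
      ∑ x ∈ Λ \ S, ∑ y ∈ neighbours x ∩ (Λ \ S), s x * s y +
        ∑ x ∈ Λ \ S, ∑ y ∈ neighbours x ∩ S, s x * s y := by
    rw [← Finset.sum_add_distrib]
    refine Finset.sum_congr rfl fun x _ => ?_
    rw [← Finset.sum_union]
    · rw [← Finset.inter_union_distrib_left, Finset.sdiff_union_of_subset h]
    · exact Finset.disjoint_of_subset_left Finset.inter_subset_right
        (Finset.disjoint_of_subset_right Finset.inter_subset_right Finset.sdiff_disjoint)
  -- A bond crossing the boundary of `S` is met from both ends on the left-hand side, so its two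
  -- halves add up to a single full term.
  have h4 : ∑ x ∈ Λ \ S, ∑ y ∈ neighbours x ∩ S, s x * s y =
      ∑ x ∈ S, ∑ y ∈ neighbours x \ S, s x * s y := by
    rw [Finset.sum_comm' (s' := fun y => neighbours y \ S) (t' := S)]
    · exact Finset.sum_congr rfl fun _ _ => Finset.sum_congr rfl fun _ _ => mul_comm _ _
    · intro x y
      simp only [Finset.mem_sdiff, Finset.mem_inter]
      rw [neighbours_comm]
      refine ⟨fun h' => ⟨⟨h'.2.1, h'.1.2⟩, h'.2.2⟩, fun h' => ⟨⟨hN y h'.2 h'.1.1, h'.1.2⟩, h'.1.1, h'.2⟩⟩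
  rw [h1, h2, h3, h4]
  ring

lemma sum_filter_subtype_prod (S R : Finset (Site ν)) (f : Site ν → Site ν → ℝ) :
    ∑ e ∈ Finset.univ.filter (fun e : ↥S × ↥R => (e.2 : Site ν) ∈ neighbours (e.1 : Site ν)),
      f e.1 e.2 = ∑ x ∈ S, ∑ y ∈ neighbours x ∩ R, f x y := by
  rw [Finset.sum_filter, Fintype.sum_prod_type,
    ← Finset.sum_coe_sort S fun x => ∑ y ∈ neighbours x ∩ R, f x y]
  refine Finset.sum_congr rfl fun x _ => ?_
  rw [Finset.sum_coe_sort R fun y => if y ∈ neighbours (x : Site ν) then f x y else 0,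
    ← Finset.sum_filter]
  refine Finset.sum_congr ?_ fun _ _ => rfl
  ext y; simp [and_comm]

lemma extend_of_mem {S : Finset (Site ν)} (b : ℝ) (τ : S → ℤˣ) {x : Site ν} (hx : x ∈ S) :
    extend S b τ x = ((τ ⟨x, hx⟩ : ℤ) : ℝ) := dif_pos hx

lemma exp_neg_energy_zero_div (J T : ℝ) (S : Finset (Site ν)) (τ : S → ℤˣ) :
    Real.exp (-energy J S 0 τ / T) = pairWeight Prod.fst Prod.snd (fun _ => J / T / 2)
      (Finset.univ.filter fun e : ↥S × ↥S => (e.2 : Site ν) ∈ neighbours (e.1 : Site ν)) τ := by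
  rw [neg_energy_zero_div, pairWeight, sum_pairs S fun x y =>
    J / T / 2 * signFunction _ (siteChar S x * siteChar S y) τ, ← sum_filter_subtype_prod]
  refine congrArg _ (Finset.sum_congr rfl fun e _ => ?_)
  simp [siteChar, bondSign]

/-- The weight of the exterior spins of `Λ`, with plus boundary conditions. -/
noncomputable def exteriorWeight (K : ℝ) (S Λ : Finset (Site ν)) (τ : ↥(Λ \ S) → ℤˣ) : ℝ :=
  Real.exp (K * ((1 / 2) * ∑ x ∈ Λ \ S, ∑ y ∈ neighbours x ∩ (Λ \ S),
      extend (Λ \ S) 1 τ x * extend (Λ \ S) 1 τ y +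
    ∑ x ∈ Λ \ S, ∑ y ∈ neighbours x \ Λ, extend (Λ \ S) 1 τ x * extend (Λ \ S) 1 τ y))

lemma exteriorWeight_mem {K : ℝ} (hK : 0 ≤ K) (S Λ : Finset (Site ν)) :
    exteriorWeight K S Λ ∈ positiveType (↥(Λ \ S) → ℤˣ) := by
  set χ : (Σ _ : Site ν, Site ν) → (↥(Λ \ S) → ℤˣ) →* ℤˣ :=
    fun e => siteChar (Λ \ S) e.1 * siteChar (Λ \ S) e.2
  have h : exteriorWeight K S Λ =
      (fun τ => Real.exp (∑ e ∈ (Λ \ S).sigma fun x => neighbours x ∩ (Λ \ S),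
        (K * (1 / 2)) * signFunction _ (χ e) τ)) *
      fun τ => Real.exp (∑ e ∈ (Λ \ S).sigma fun x => neighbours x \ Λ,
        K * signFunction _ (χ e) τ) := by
    ext τ
    simp only [exteriorWeight, Pi.mul_apply, ← Real.exp_add, ← Finset.mul_sum, Finset.sum_sigma,
      extend_one, χ, map_mul]
    ring_nf
  rw [h]
  exact mul_mem (exp_mem_positiveType _ (fun _ _ => by positivity) χ)
    (exp_mem_positiveType _ (fun _ _ => hK) χ)

lemma exp_mul_sign (K : ℝ) (u : ℤˣ) :
    Real.exp (K * ((u : ℤ) : ℝ)) = Real.cosh K * (1 + Real.tanh K * ((u : ℤ) : ℝ)) := by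
  rw [Real.tanh_eq_sinh_div_cosh]
  have := (Real.cosh_pos K).ne'
  rcases Int.units_eq_one_or u with h | h
  · rw [h]; field_simp; simp
  · rw [h]; field_simp; simp [← sub_eq_add_neg]

/-- Brings the plus weight into the form required by `simonLieb`. Bonds inside `S` carry `J / T / 2`
because both orientations are counted, whereas a crossing bond is counted once; the constant product
of `cosh` cancels in expectations. -/
lemma exp_neg_energy_one_div (J T : ℝ) {S Λ : Finset (Site ν)} (h : S ⊆ Λ)
    (hN : ∀ x ∈ S, neighbours x ⊆ Λ) (σ : Λ → ℤˣ) :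
    Real.exp (-energy J Λ 1 σ / T) = (∏ _ ∈ Finset.univ.filter
        (fun e : ↥S × ↥(Λ \ S) => (e.2 : Site ν) ∈ neighbours (e.1 : Site ν)), Real.cosh (J / T)) *
      (pairWeight Prod.fst Prod.snd (fun _ => J / T / 2)
        (Finset.univ.filter fun e : ↥S × ↥S => (e.2 : Site ν) ∈ neighbours (e.1 : Site ν))
          (splitEquiv h σ).1 *
      (∏ e ∈ Finset.univ.filter
        (fun e : ↥S × ↥(Λ \ S) => (e.2 : Site ν) ∈ neighbours (e.1 : Site ν)),
          (1 + Real.tanh (J / T) * crossSign Prod.fst (fun e => spinChar e.2) e (splitEquiv h σ))) *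
      exteriorWeight (J / T) S Λ (splitEquiv h σ).2) := by
  have hin : ∀ x ∈ S, extend S 0 (splitEquiv h σ).1 x = extend Λ 1 σ x := fun x hx => by
    rw [extend_zero _ hx, extend_one, signFunction_apply, signFunction_apply,
      siteChar_split_fst h hx]
  have hout : ∀ x ∉ S, extend (Λ \ S) 1 (splitEquiv h σ).2 x = extend Λ 1 σ x := fun x hx => by
    rw [extend_one, extend_one, signFunction_apply, signFunction_apply, siteChar_split_snd h hx]
  have hcross : ∑ e ∈ Finset.univ.filter
      (fun e : ↥S × ↥(Λ \ S) => (e.2 : Site ν) ∈ neighbours (e.1 : Site ν)),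
        J / T * crossSign Prod.fst (fun e => spinChar e.2) e (splitEquiv h σ) =
      ∑ x ∈ S, ∑ y ∈ neighbours x \ S, J / T * (extend Λ 1 σ x * extend Λ 1 σ y) := by
    have : ∀ x ∈ S, neighbours x \ S = neighbours x ∩ (Λ \ S) := fun x hx => by
      rw [← Finset.inter_sdiff_assoc, Finset.inter_eq_left.2 (hN x hx)]
    rw [Finset.sum_congr rfl fun x hx => congrArg
      (Finset.sum · fun y => J / T * (extend Λ 1 σ x * extend Λ 1 σ y)) (this x hx),
      ← sum_filter_subtype_prod]
    refine Finset.sum_congr rfl fun e _ => ?_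
    have h1 := (Finset.mem_sdiff.1 e.2.2)
    rw [extend_of_mem 1 σ (h e.1.2), extend_of_mem 1 σ h1.1]
    simp [crossSign, splitEquiv]
  have hprod : (∏ _ ∈ Finset.univ.filter
        (fun e : ↥S × ↥(Λ \ S) => (e.2 : Site ν) ∈ neighbours (e.1 : Site ν)), Real.cosh (J / T)) *
      (∏ e ∈ Finset.univ.filter
        (fun e : ↥S × ↥(Λ \ S) => (e.2 : Site ν) ∈ neighbours (e.1 : Site ν)),
          (1 + Real.tanh (J / T) * crossSign Prod.fst (fun e => spinChar e.2) e (splitEquiv h σ))) =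
      Real.exp (∑ x ∈ S, ∑ y ∈ neighbours x \ S, J / T * (extend Λ 1 σ x * extend Λ 1 σ y)) := by
    rw [← hcross, Real.exp_sum, ← Finset.prod_mul_distrib]
    exact Finset.prod_congr rfl fun e _ => (exp_mul_sign _ _).symm
  have hext : exteriorWeight (J / T) S Λ (splitEquiv h σ).2 = Real.exp (J / T * ((1 / 2) *
      ∑ x ∈ Λ \ S, ∑ y ∈ neighbours x ∩ (Λ \ S), extend Λ 1 σ x * extend Λ 1 σ y +
      ∑ x ∈ Λ \ S, ∑ y ∈ neighbours x \ Λ, extend Λ 1 σ x * extend Λ 1 σ y)) := by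
    rw [exteriorWeight]
    congr 3
    · congr 1
      refine Finset.sum_congr rfl fun x hx => Finset.sum_congr rfl fun y hy => ?_
      rw [hout x (Finset.mem_sdiff.1 hx).2,
        hout y (Finset.mem_sdiff.1 (Finset.mem_inter.1 hy).2).2]
    · refine Finset.sum_congr rfl fun x hx => Finset.sum_congr rfl fun y hy => ?_
      rw [hout x (Finset.mem_sdiff.1 hx).2, hout y fun hS => (Finset.mem_sdiff.1 hy).2 (h hS)]
  have hint : -energy J S 0 (splitEquiv h σ).1 / T = J / T * ((1 / 2) *
      ∑ x ∈ S, ∑ y ∈ neighbours x ∩ S, extend Λ 1 σ x * extend Λ 1 σ y) := by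
    have h0 : ∑ x ∈ S, ∑ y ∈ neighbours x \ S,
        extend S 0 (splitEquiv h σ).1 x * extend S 0 (splitEquiv h σ).1 y = 0 :=
      Finset.sum_eq_zero fun x _ => Finset.sum_eq_zero fun y hy => by
        simp [extend, (Finset.mem_sdiff.1 hy).2]
    have h1 : ∑ x ∈ S, ∑ y ∈ neighbours x ∩ S,
        extend S 0 (splitEquiv h σ).1 x * extend S 0 (splitEquiv h σ).1 y =
        ∑ x ∈ S, ∑ y ∈ neighbours x ∩ S, extend Λ 1 σ x * extend Λ 1 σ y :=
      Finset.sum_congr rfl fun x hx => Finset.sum_congr rfl fun y hy => by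
        rw [hin x hx, hin y (Finset.mem_inter.1 hy).2]
    rw [energy, h0, h1]
    ring
  have hall := bondSum_split h hN (extend Λ 1 σ)
  rw [← exp_neg_energy_zero_div, hext, mul_assoc, mul_left_comm, ← mul_assoc (∏ _ ∈ _, _), hprod,
    ← Real.exp_add, ← Real.exp_add, energy, hall, hint]
  simp only [← Finset.mul_sum]
  congr 1
  ring

lemma tanh_nonneg {K : ℝ} (hK : 0 ≤ K) : 0 ≤ Real.tanh K := by
  rw [Real.tanh_eq_sinh_div_cosh]
  exact div_nonneg (Real.sinh_nonneg_iff.2 hK) (Real.cosh_pos _).le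

/-- The Simon–Lieb inequality for the magnetisation with plus boundary conditions. -/
lemma gibbs_plus_le {J T : ℝ} (hK : 0 ≤ J / T) {S Λ : Finset (Site ν)} (h : S ⊆ Λ)
    (hN : ∀ x ∈ S, neighbours x ⊆ Λ) {o : Site ν} (ho : o ∈ S) :
    gibbs J T Λ 1 (fun s => s o) ≤ ∑ x ∈ S, ∑ y ∈ neighbours x \ S,
      Real.tanh (J / T) * gibbs J T S 0 (fun s => s o * s x) * gibbs J T Λ 1 fun s => s y := by
  set E := Finset.univ.filter
    (fun e : ↥S × ↥(Λ \ S) => (e.2 : Site ν) ∈ neighbours (e.1 : Site ν)) with hE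
  set w : (↥S → ℤˣ) × (↥(Λ \ S) → ℤˣ) → ℝ := fun τ =>
    pairWeight Prod.fst Prod.snd (fun _ => J / T / 2)
      (Finset.univ.filter fun e : ↥S × ↥S => (e.2 : Site ν) ∈ neighbours (e.1 : Site ν)) τ.1 *
      (∏ e ∈ E, (1 + Real.tanh (J / T) * crossSign Prod.fst (fun e => spinChar e.2) e τ)) *
      exteriorWeight (J / T) S Λ τ.2 with hw
  have ht : 0 ≤ Real.tanh (J / T) := tanh_nonneg hK
  have key := simonLieb Prod.fst Prod.snd Prod.fst (fun e : ↥S × ↥(Λ \ S) => spinChar e.2)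
    (J := fun _ => J / T / 2)
    (Finset.univ.filter fun e : ↥S × ↥S => (e.2 : Site ν) ∈ neighbours (e.1 : Site ν))
    (fun _ _ => div_nonneg hK zero_le_two) ⟨o, ho⟩ E (t := fun _ => Real.tanh (J / T))
    (fun _ _ => ht) (exteriorWeight_mem hK S Λ)
  set c : ℝ := ∏ _ ∈ E, Real.cosh (J / T) with hc
  have hc0 : 0 < c := Finset.prod_pos fun _ _ => Real.cosh_pos _
  have hwpos : 0 < ∑ τ, w τ := by
    have : 0 < ∑ σ, Real.exp (-energy J Λ 1 σ / T) := sum_exp_pos _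
    simp only [exp_neg_energy_one_div J T h hN] at this
    rw [← Finset.mul_sum, Equiv.sum_comp (splitEquiv h) w] at this
    exact pos_of_mul_pos_right this hc0.le
  have hplus : ∀ f : (↥S → ℤˣ) × (↥(Λ \ S) → ℤˣ) → ℝ, ∀ g : (Site ν → ℝ) → ℝ,
      (∀ σ, g (extend Λ 1 σ) = f (splitEquiv h σ)) →
      gibbs J T Λ 1 g = (∑ τ, f τ * w τ) / ∑ τ, w τ := by
    intro f g hfg
    rw [gibbs, ← mul_div_mul_left (∑ τ, f τ * w τ) (∑ τ, w τ) hc0.ne', Finset.mul_sum,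
      Finset.mul_sum, ← Equiv.sum_comp (splitEquiv h), ← Equiv.sum_comp (splitEquiv h)]
    simp only [hfg, exp_neg_energy_one_div J T h hN]
    congr 1
    exact Finset.sum_congr rfl fun σ _ => mul_left_comm _ _ _
  have hfree : ∀ x (hx : x ∈ S), gibbs J T S 0 (fun s => s o * s x) =
      (∑ τ : S → ℤˣ, ((τ ⟨o, ho⟩ : ℤ) : ℝ) * ((τ ⟨x, hx⟩ : ℤ) : ℝ) *
        pairWeight Prod.fst Prod.snd (fun _ => J / T / 2) (Finset.univ.filter
          fun e : ↥S × ↥S => (e.2 : Site ν) ∈ neighbours (e.1 : Site ν)) τ) /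
      ∑ τ, pairWeight Prod.fst Prod.snd (fun _ => J / T / 2) (Finset.univ.filter
          fun e : ↥S × ↥S => (e.2 : Site ν) ∈ neighbours (e.1 : Site ν)) τ := by
    intro x hx
    simp only [gibbs, exp_neg_energy_zero_div, extend_of_mem 0 _ ho, extend_of_mem 0 _ hx]
  have hZ : 0 < ∑ τ, pairWeight Prod.fst Prod.snd (fun _ => J / T / 2) (Finset.univ.filter
      fun e : ↥S × ↥S => (e.2 : Site ν) ∈ neighbours (e.1 : Site ν)) τ := sum_exp_pos _
  have hsub : ∀ x ∈ S, neighbours x \ S = neighbours x ∩ (Λ \ S) := fun x hx => by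
    rw [← Finset.inter_sdiff_assoc, Finset.inter_eq_left.2 (hN x hx)]
  rw [Finset.sum_congr rfl fun x hx => congrArg (Finset.sum · _) (hsub x hx),
    ← sum_filter_subtype_prod S (Λ \ S) fun x y =>
      Real.tanh (J / T) * gibbs J T S 0 (fun s => s o * s x) * gibbs J T Λ 1 fun s => s y,
    hplus (fun τ => ((τ.1 ⟨o, ho⟩ : ℤ) : ℝ)) _ fun σ => by
      rw [extend_of_mem 1 σ (h ho)]; rfl, div_le_iff₀ hwpos]
  refine (le_div_iff₀ hZ).2 key |>.trans (le_of_eq ?_)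
  rw [Finset.sum_div, Finset.sum_mul]
  refine Finset.sum_congr rfl fun e _ => ?_
  rw [hfree e.1 e.1.2, hplus (fun τ => ((τ.2 e.2 : ℤ) : ℝ)) (fun s => s e.2) fun σ => by
      rw [extend_of_mem 1 σ (Finset.mem_sdiff.1 e.2.2).1]; rfl]
  have halg : ∀ t A B Z W : ℝ, W ≠ 0 → t * A * B / Z = t * (A / Z) * (B / W) * W := by
    intro t A B Z W hW; field_simp
  exact halg _ _ _ _ _ hwpos.ne'

/-! ### Boundary sums and the critical temperature -/

lemma mem_box {n : ℕ} {x : Site ν} : x ∈ box ν n ↔ ∀ i, |x i| ≤ n := by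
  simp only [box, Finset.mem_Icc, Pi.le_def, abs_le]
  exact ⟨fun h i => ⟨h.1 i, h.2 i⟩, fun h => ⟨fun i => (h i).1, fun i => (h i).2⟩⟩

lemma zero_mem_box (n : ℕ) : (0 : Site ν) ∈ box ν n := by simp [mem_box]

lemma abs_sub_le_of_mem_neighbours {x y : Site ν} (h : y ∈ neighbours x) (i : Fin ν) :
    |y i - x i| ≤ 1 := by
  have h1 := Finset.mem_Icc.1 (Finset.mem_filter.1 h).1
  have h2 := h1.1 i
  have h3 := h1.2 i
  simp only [Pi.sub_apply, Pi.add_apply, Pi.one_apply] at h2 h3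
  rw [abs_le]; constructor <;> linarith

/-- The quantity `∑ tanh (J / T) ⟨σ₀ σ_x⟩`, summed over the bonds `{x, y}` with `x ∈ S`,
`y ∉ S`, in the free state on `S`. -/
noncomputable def boundarySum (J T : ℝ) (S : Finset (Site ν)) : ℝ :=
  ∑ x ∈ S, ∑ _y ∈ neighbours x \ S,
    Real.tanh (J / T) * gibbs J T S 0 fun s => s 0 * s x

lemma tanh_le_one (K : ℝ) : Real.tanh K ≤ 1 := by
  rw [Real.tanh_eq_sinh_div_cosh]
  exact (div_le_one (Real.cosh_pos _)).2 (Real.sinh_lt_cosh K).le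

lemma gibbs_mul_eq_prod (J T : ℝ) (Λ : Finset (Site ν)) (b : ℝ) {x y : Site ν} (h : x ≠ y) :
    gibbs J T Λ b (fun s => s x * s y) = gibbs J T Λ b fun s => ∏ z ∈ {x, y}, s z := by
  simp only [Finset.prod_pair h]

lemma gibbs_mul_self (J T : ℝ) {Λ : Finset (Site ν)} (b : ℝ) {x : Site ν} (h : x ∈ Λ) :
    gibbs J T Λ b (fun s => s x * s x) = 1 := by
  have : ∀ σ : Λ → ℤˣ, extend Λ b σ x * extend Λ b σ x = 1 := fun σ => by
    rw [extend_of_mem b σ h, ← Int.cast_mul, Int.units_coe_mul_self, Int.cast_one]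
  simp only [gibbs, this, one_mul]
  exact div_self (sum_exp_pos _).ne'

lemma gibbs_mul_nonneg {J T : ℝ} (hK : 0 ≤ J / T) {Λ : Finset (Site ν)} {x y : Site ν}
    (hx : x ∈ Λ) (hy : y ∈ Λ) : 0 ≤ gibbs J T Λ 0 fun s => s x * s y := by
  by_cases h : x = y
  · rw [h, gibbs_mul_self J T 0 hy]; exact zero_le_one
  · rw [gibbs_mul_eq_prod J T Λ 0 h]
    refine gibbs_prod_nonneg hK fun z hz => ?_
    rcases Finset.mem_insert.1 hz with rfl | hz
    · exact hx
    · rwa [Finset.mem_singleton.1 hz]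

lemma gibbs_plus_spin_le_one (J T : ℝ) (Λ : Finset (Site ν)) (x : Site ν) :
    gibbs J T Λ 1 (fun s => s x) ≤ 1 :=
  gibbs_le_one fun σ => (abs_le.1 (abs_extend_le (by simp) σ x)).2

lemma neg_one_le_gibbs_plus_spin (J T : ℝ) (Λ : Finset (Site ν)) (x : Site ν) :
    -1 ≤ gibbs J T Λ 1 fun s => s x := by
  have h : gibbs J T Λ 1 (fun s => -s x) ≤ 1 :=
    gibbs_le_one fun σ => neg_le.1 (abs_le.1 (abs_extend_le (by simp) σ x)).1
  have : gibbs J T Λ 1 (fun s => -s x) = -gibbs J T Λ 1 fun s => s x := by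
    simp [gibbs, neg_div]
  linarith

lemma boundarySum_nonneg {J T : ℝ} (hK : 0 ≤ J / T) (m : ℕ) :
    0 ≤ boundarySum J T (box ν m) :=
  Finset.sum_nonneg fun _ hx => Finset.sum_nonneg fun _ _ =>
    mul_nonneg (tanh_nonneg hK) (gibbs_mul_nonneg hK (zero_mem_box m) hx)

/-- One Simon–Lieb step around the cube centred at `y` passes to sites just outside it, which differ
from `y` by at most `m + 1` in each coordinate. A margin of `k * (m + 1)` therefore leaves room for
`k` steps, each costing one factor. -/
lemma gibbs_plus_le_pow {J T : ℝ} (hK : 0 ≤ J / T) (m k n : ℕ) (y : Site ν)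
    (hy : ∀ i, |y i| + k * (m + 1) ≤ n) :
    gibbs J T (box ν n) 1 (fun s => s y) ≤ boundarySum J T (box ν m) ^ k := by
  induction k generalizing y with
  | zero => simpa using gibbs_plus_spin_le_one J T _ y
  | succ k ih =>
    set S := translate y (box ν m) with hS
    have hclose : ∀ x ∈ S, ∀ i, |x i| + (1 + k * (m + 1)) ≤ n := fun x hx i => by
      have h1 := mem_box.1 (mem_translate.1 hx) i
      have h2 := hy i
      have h3 := abs_sub_abs_le_abs_sub (x i) (y i)
      simp only [Pi.sub_apply] at h1
      push_cast at h2
      linarith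
    have hclose' : ∀ x ∈ S, ∀ z ∈ neighbours x, ∀ i, |z i| + k * (m + 1) ≤ n :=
      fun x hx z hz i => by
        have h1 := hclose x hx i
        have h2 := abs_sub_le_of_mem_neighbours hz i
        have h3 := abs_sub_abs_le_abs_sub (z i) (x i)
        linarith
    have hk : (0 : ℤ) ≤ k * (m + 1) := by positivity
    have hSΛ : S ⊆ box ν n := fun x hx => mem_box.2 fun i => by linarith [hclose x hx i]
    have hN : ∀ x ∈ S, neighbours x ⊆ box ν n := fun x hx z hz =>
      mem_box.2 fun i => by linarith [hclose' x hx z hz i]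
    have hyS : y ∈ S := mem_translate.2 (by simpa using zero_mem_box m)
    calc gibbs J T (box ν n) 1 (fun s => s y)
        ≤ ∑ x ∈ S, ∑ z ∈ neighbours x \ S, Real.tanh (J / T) *
            gibbs J T S 0 (fun s => s y * s x) * gibbs J T (box ν n) 1 fun s => s z :=
          gibbs_plus_le hK hSΛ hN hyS
      _ ≤ ∑ x ∈ S, ∑ z ∈ neighbours x \ S, Real.tanh (J / T) *
            gibbs J T S 0 (fun s => s y * s x) * boundarySum J T (box ν m) ^ k := by
          refine Finset.sum_le_sum fun x hx => Finset.sum_le_sum fun z hz => ?_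
          exact mul_le_mul_of_nonneg_left
            (ih z fun i => hclose' x hx z (Finset.mem_sdiff.1 hz).1 i)
            (mul_nonneg (tanh_nonneg hK) (gibbs_mul_nonneg hK hyS hx))
      _ = boundarySum J T (box ν m) ^ (k + 1) := by
          rw [pow_succ', boundarySum, Finset.sum_mul, hS, sum_translate]
          refine Finset.sum_congr rfl fun x _ => ?_
          rw [neighbours_add, translate_sdiff, sum_translate, Finset.sum_mul]
          refine Finset.sum_congr rfl fun z _ => ?_
          rw [← gibbs_translate J T y (box ν m) 0 fun s => s 0 * s x]
          simp only [zero_add]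

lemma magnetisation_nonpos {J T : ℝ} (hK : 0 ≤ J / T) {m : ℕ}
    (h : boundarySum J T (box ν m) < 1) : magnetisation ν J T ≤ 0 := by
  have hle : ∀ k : ℕ, magnetisation ν J T ≤ boundarySum J T (box ν m) ^ k := fun k => by
    refine limsup_le_of_le (IsBoundedUnder.isCoboundedUnder_le
      (isBoundedUnder_of ⟨-1, fun n => neg_one_le_gibbs_plus_spin J T _ 0⟩)) ?_
    filter_upwards [eventually_ge_atTop (k * (m + 1))] with n hn
    refine gibbs_plus_le_pow hK m k n 0 fun i => ?_
    simpa using (by exact_mod_cast hn : ((k * (m + 1) : ℕ) : ℤ) ≤ n)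
  exact ge_of_tendsto' (tendsto_pow_atTop_nhds_zero_of_lt_one (boundarySum_nonneg hK m) h) hle

lemma continuousAt_gibbs (J : ℝ) {T : ℝ} (hT : T ≠ 0) (Λ : Finset (Site ν)) (b : ℝ)
    (g : (Site ν → ℝ) → ℝ) : ContinuousAt (fun T => gibbs J T Λ b g) T := by
  have h : ∀ σ : Λ → ℤˣ, ContinuousAt (fun T => Real.exp (-energy J Λ b σ / T)) T := fun σ =>
    (continuousAt_const.div continuousAt_id hT).rexp
  refine ContinuousAt.div ?_ ?_ (sum_exp_pos _).ne'
  · exact tendsto_finsetSum _ fun σ _ => continuousAt_const.mul (h σ)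
  · exact tendsto_finsetSum _ fun σ _ => h σ

lemma continuousAt_boundarySum (J : ℝ) {T : ℝ} (hT : T ≠ 0) (S : Finset (Site ν)) :
    ContinuousAt (fun T => boundarySum J T S) T := by
  have h : ContinuousAt (fun T => Real.tanh (J / T)) T := by
    simp only [Real.tanh_eq_sinh_div_cosh]
    have h1 : ContinuousAt (fun T => J / T) T := continuousAt_const.div continuousAt_id hT
    exact (Real.continuous_sinh.continuousAt.comp h1).div
      (Real.continuous_cosh.continuousAt.comp h1) (Real.cosh_pos _).ne'
  exact tendsto_finsetSum _ fun x _ => tendsto_finsetSum _ fun y _ =>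
    h.mul (continuousAt_gibbs J hT S 0 _)

lemma criticalTemp_nonneg (ν : ℕ) (J : ℝ) : 0 ≤ criticalTemp ν J :=
  Real.sSup_nonneg fun _ h => h.1.le

/-- At the critical temperature, the boundary sums do not fall below `1`. -/
lemma one_le_boundarySum {J : ℝ} (hJ : 0 ≤ J) (hT : 0 < criticalTemp ν J) (m : ℕ) :
    1 ≤ boundarySum J (criticalTemp ν J) (box ν m) := by
  by_contra! hlt
  set A := {T : ℝ | 0 < T ∧ 0 < magnetisation ν J T} with hA
  -- `sSup` is `0` by default on empty and on unbounded sets of reals, so positivity of the critical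
  -- temperature excludes both.
  have hne : A.Nonempty := by
    by_contra h
    rw [Set.not_nonempty_iff_eq_empty] at h
    rw [criticalTemp, ← hA, h, Real.sSup_empty] at hT
    exact lt_irrefl _ hT
  have hbdd : BddAbove A := by
    by_contra h
    rw [criticalTemp, ← hA, Real.sSup_of_not_bddAbove h] at hT
    exact lt_irrefl _ hT
  -- A boundary sum below `1` stays so near `T_c`, hence also at some magnetised temperature within
  -- `ε` of the supremum.
  obtain ⟨ε, hε, hball⟩ := Metric.eventually_nhds_iff.1
    ((continuousAt_boundarySum J hT.ne' (box ν m)).eventually_lt_const hlt)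
  obtain ⟨T, hTA, hTlt⟩ := exists_lt_of_lt_csSup hne (sub_lt_self (sSup A) hε)
  have hTle : T ≤ sSup A := le_csSup hbdd hTA
  have hdist : dist T (criticalTemp ν J) < ε := by
    rw [Real.dist_eq, abs_lt]
    change -ε < T - sSup A ∧ T - sSup A < ε
    constructor <;> linarith
  exact absurd hTA.2 (not_lt.2 (magnetisation_nonpos (div_nonneg hJ hTA.1.le) (hball hdist)))

/-! ### Correlations of the infinite-volume free state -/

lemma measurable_spin (x : Site ν) : Measurable (spin x : Config ν → ℝ) :=
  (measurable_of_countable fun u : ℤ => (u : ℝ)).comp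
    ((comap_measurable Units.val).comp (measurable_pi_apply x))

lemma spin_mul_self (x : Site ν) (σ : Config ν) : spin x σ * spin x σ = 1 := by
  rw [spin, ← Int.cast_mul, Int.units_coe_mul_self, Int.cast_one]

lemma abs_spin (x : Site ν) (σ : Config ν) : |spin x σ| = 1 := by
  rcases Int.units_eq_one_or (σ x) with h | h <;> simp [spin, h]

lemma gibbs_zero_spin (J T : ℝ) (Λ : Finset (Site ν)) (x : Site ν) :
    gibbs J T Λ 0 (fun s => s x) = 0 := by
  have hext : ∀ (σ : Λ → ℤˣ) y, extend Λ 0 (-σ) y = -extend Λ 0 σ y := fun σ y => by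
    by_cases h : y ∈ Λ <;> simp [extend, h]
  have hen : ∀ σ : Λ → ℤˣ, energy J Λ 0 (-σ) = energy J Λ 0 σ := fun σ => by
    simp only [energy, hext, neg_mul_neg]
  have h := Equiv.sum_comp (Equiv.neg (Λ → ℤˣ))
    fun σ => extend Λ 0 σ x * Real.exp (-energy J Λ 0 σ / T)
  simp only [Equiv.neg_apply, hext, hen, neg_mul, Finset.sum_neg_distrib] at h
  rw [gibbs, div_eq_zero_iff]
  left
  linarith

/-- Division by zero gives `0`, so formally at `T = 0` all configurations have equal weight, and
flipping the spin at `x` alone kills the correlation. This serves to rule out the default value `T_c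
= 0`. -/
lemma gibbs_zero_temp_mul (J : ℝ) (Λ : Finset (Site ν)) {x y : Site ν} (hxy : x ≠ y) :
    gibbs J 0 Λ 0 (fun s => s x * s y) = 0 := by
  simp only [gibbs, div_zero, Real.exp_zero, mul_one]
  rw [div_eq_zero_iff]
  left
  by_cases hx : x ∈ Λ
  · have h := Equiv.sum_comp (Equiv.mulLeft (Pi.mulSingle (⟨x, hx⟩ : Λ) (-1 : ℤˣ)))
      fun σ : Λ → ℤˣ => extend Λ 0 σ x * extend Λ 0 σ y
    have h1 : ∀ σ : Λ → ℤˣ, extend Λ 0 (Pi.mulSingle (⟨x, hx⟩ : Λ) (-1 : ℤˣ) * σ) x =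
        -extend Λ 0 σ x := fun σ => by simp [extend, hx]
    have h2 : ∀ σ : Λ → ℤˣ, extend Λ 0 (Pi.mulSingle (⟨x, hx⟩ : Λ) (-1 : ℤˣ) * σ) y =
        extend Λ 0 σ y := fun σ => by
      by_cases hy : y ∈ Λ
      · have : (⟨y, hy⟩ : Λ) ≠ ⟨x, hx⟩ := fun h => hxy (congrArg Subtype.val h).symm
        simp [extend, hy, Pi.mulSingle_eq_of_ne this]
      · simp [extend, hy]
    simp only [Equiv.coe_mulLeft, h1, h2, neg_mul, Finset.sum_neg_distrib] at h
    linarith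
  · exact Finset.sum_eq_zero fun σ _ => by simp [extend, hx]

lemma eventually_subset_box (S : Finset (Site ν)) : ∀ᶠ n : ℕ in atTop, S ⊆ box ν n := by
  have h : ∀ x ∈ S, ∀ᶠ n : ℕ in atTop, x ∈ box ν n := fun x _ => by
    have : ∀ i, ∀ᶠ n : ℕ in atTop, |x i| ≤ n := fun i => by
      filter_upwards [eventually_ge_atTop (x i).natAbs] with n hn
      rw [Int.abs_eq_natAbs]; exact_mod_cast hn
    filter_upwards [eventually_all.2 this] with n hn using mem_box.2 hn
  exact (Finset.eventually_all S).2 h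

namespace IsFreeState

variable {J T : ℝ} {μ : Measure (Config ν)}

lemma integral_spin (hμ : IsFreeState ν J T μ) (x : Site ν) : ∫ σ, spin x σ ∂μ = 0 := by
  have h := hμ.2 {x}
  simp only [Finset.prod_singleton, gibbs_zero_spin] at h
  exact tendsto_nhds_unique h tendsto_const_nhds

lemma integral_spin_mul_self (hμ : IsFreeState ν J T μ) (x : Site ν) : ∫ σ, spin x σ * spin x σ ∂μ = 1 := by
  have := hμ.1
  simp [spin_mul_self]

lemma tendsto_gibbs (hμ : IsFreeState ν J T μ) (x y : Site ν) :
    Tendsto (fun n : ℕ => gibbs J T (box ν n) 0 fun s => s x * s y)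
    atTop (𝓝 (∫ σ, spin x σ * spin y σ ∂μ)) := by
  by_cases h : x = y
  · subst h
    rw [hμ.integral_spin_mul_self]
    refine tendsto_const_nhds.congr' ?_
    filter_upwards [eventually_subset_box {x}] with n hn
    exact (gibbs_mul_self J T 0 (hn (Finset.mem_singleton_self x))).symm
  · simpa only [Finset.prod_pair h] using hμ.2 {x, y}

end IsFreeState

lemma integrable_spin_mul_spin (μ : Measure (Config ν)) [IsFiniteMeasure μ] (x y : Site ν) :
    Integrable (fun σ => spin x σ * spin y σ) μ :=
  Integrable.of_bound ((measurable_spin x).mul (measurable_spin y)).aestronglyMeasurable 1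
    (Eventually.of_forall fun σ => by simp [abs_spin])

namespace IsFreeState

variable {J T : ℝ} {μ : Measure (Config ν)}

lemma gibbs_le_integral (hμ : IsFreeState ν J T μ) (hK : 0 ≤ J / T) {S : Finset (Site ν)}
    {x y : Site ν} (hx : x ∈ S) (hy : y ∈ S) :
    gibbs J T S 0 (fun s => s x * s y) ≤ ∫ σ, spin x σ * spin y σ ∂μ := by
  by_cases h : x = y
  · subst h
    rw [gibbs_mul_self J T 0 hx, hμ.integral_spin_mul_self]
  · refine ge_of_tendsto (hμ.tendsto_gibbs x y) ?_
    filter_upwards [eventually_subset_box S] with n hn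
    rw [gibbs_mul_eq_prod J T _ 0 h, gibbs_mul_eq_prod J T _ 0 h]
    exact gibbs_prod_mono hK (Finset.insert_subset hx (Finset.singleton_subset_iff.2 hy)) hn

lemma integral_nonneg (hμ : IsFreeState ν J T μ) (hK : 0 ≤ J / T) (x y : Site ν) :
    0 ≤ ∫ σ, spin x σ * spin y σ ∂μ :=
  (gibbs_mul_nonneg (Λ := {x, y}) hK (by simp) (by simp)).trans
    (hμ.gibbs_le_integral hK (by simp) (by simp))

/-- Shifting a cube by `-a` gives another finite volume, whose free correlations lie below the limit
by monotonicity. The opposite shift turns this into translation invariance. -/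
lemma integral_translate_le (hμ : IsFreeState ν J T μ) (hK : 0 ≤ J / T) (x y a : Site ν) :
    ∫ σ, spin (x + a) σ * spin (y + a) σ ∂μ ≤ ∫ σ, spin x σ * spin y σ ∂μ := by
  refine le_of_tendsto (hμ.tendsto_gibbs (x + a) (y + a)) ?_
  filter_upwards [eventually_subset_box {x + a, y + a}] with n hn
  rw [← gibbs_translate J T (-a)]
  simp only [add_assoc, add_neg_cancel, add_zero]
  refine hμ.gibbs_le_integral hK ?_ ?_ <;> rw [mem_translate, sub_neg_eq_add] <;>
    exact hn (by simp)

lemma integral_translate (hμ : IsFreeState ν J T μ) (hK : 0 ≤ J / T) (x y a : Site ν) :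
    ∫ σ, spin (x + a) σ * spin (y + a) σ ∂μ = ∫ σ, spin x σ * spin y σ ∂μ := by
  refine le_antisymm (hμ.integral_translate_le hK x y a) ?_
  simpa using hμ.integral_translate_le hK (x + a) (y + a) (-a)

lemma connected_eq (hμ : IsFreeState ν J T μ) (x : Site ν) :
    connected μ x = ∫ σ, spin x σ * spin 0 σ ∂μ := by
  simp [connected, hμ.integral_spin]

lemma integral_eq_connected (hμ : IsFreeState ν J T μ) (hK : 0 ≤ J / T) (x y : Site ν) :
    ∫ σ, spin x σ * spin y σ ∂μ = connected μ (x - y) := by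
  rw [hμ.connected_eq, ← hμ.integral_translate hK (x - y) 0 y]
  simp

lemma connected_nonneg (hμ : IsFreeState ν J T μ) (hK : 0 ≤ J / T) (x : Site ν) :
    0 ≤ connected μ x := by
  rw [hμ.connected_eq]; exact hμ.integral_nonneg hK x 0

lemma connected_le_one (hμ : IsFreeState ν J T μ) (x : Site ν) : connected μ x ≤ 1 := by
  have := hμ.1
  rw [hμ.connected_eq]
  calc ∫ σ, spin x σ * spin 0 σ ∂μ ≤ ∫ _, 1 ∂μ :=
        integral_mono (integrable_spin_mul_spin μ x 0) (integrable_const 1) fun σ => by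
          have := le_abs_self (spin x σ * spin 0 σ)
          rwa [abs_mul, abs_spin, abs_spin, one_mul] at this
    _ = 1 := by simp

lemma integral_sum_sq (hμ : IsFreeState ν J T μ) (hK : 0 ≤ J / T) (Λ : Finset (Site ν))
    (a : Site ν → ℝ) : ∫ σ, (∑ x ∈ Λ, a x * spin x σ) ^ 2 ∂μ =
      ∑ x ∈ Λ, ∑ y ∈ Λ, a x * a y * connected μ (x - y) := by
  have := hμ.1
  have h : ∀ σ, (∑ x ∈ Λ, a x * spin x σ) ^ 2 =
      ∑ x ∈ Λ, ∑ y ∈ Λ, a x * a y * (spin x σ * spin y σ) := fun σ => by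
    rw [sq, Finset.sum_mul_sum]
    exact Finset.sum_congr rfl fun x _ => Finset.sum_congr rfl fun y _ => by ring
  simp only [h]
  rw [integral_finsetSum _ fun x _ => integrable_finsetSum _ fun y _ =>
    (integrable_spin_mul_spin μ x y).const_mul _]
  refine Finset.sum_congr rfl fun x _ => ?_
  rw [integral_finsetSum _ fun y _ => (integrable_spin_mul_spin μ x y).const_mul _]
  refine Finset.sum_congr rfl fun y _ => ?_
  rw [integral_const_mul, hμ.integral_eq_connected hK]

lemma blockVariance_eq (hμ : IsFreeState ν J T μ) (hK : 0 ≤ J / T) (Λ : Finset (Site ν)) :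
    blockVariance μ Λ = ∑ x ∈ Λ, ∑ y ∈ Λ, connected μ (x - y) := by
  have := hμ.integral_sum_sq hK Λ fun _ => 1
  simpa [blockVariance, hμ.integral_spin] using this

/-- The boundary sums over cubes are controlled by the two-point function on a shell. -/
lemma boundarySum_le (hμ : IsFreeState ν J T μ) (hK : 0 ≤ J / T) (m : ℕ) :
    boundarySum J T (box ν (m + 1)) ≤
      3 ^ ν * ∑ x ∈ box ν (m + 1) \ box ν m, connected μ x := by
  have hsub : box ν m ⊆ box ν (m + 1) := fun x hx => mem_box.2 fun i =>
    (mem_box.1 hx i).trans (by push_cast; linarith)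
  -- Only the outermost layer of the cube has neighbours outside, so the boundary sum lives on the
  -- shell.
  have hinner : ∀ x ∈ box ν m, neighbours x \ box ν (m + 1) = ∅ := fun x hx => by
    rw [Finset.sdiff_eq_empty_iff_subset]
    refine fun y hy => mem_box.2 fun i => ?_
    have h1 := abs_sub_le_of_mem_neighbours hy i
    have h2 := mem_box.1 hx i
    have h3 := abs_sub_abs_le_abs_sub (y i) (x i)
    push_cast
    linarith
  have hcard : ∀ x : Site ν, ((neighbours x).card : ℝ) ≤ 3 ^ ν := fun x => by
    have h : (neighbours x).card ≤ (Finset.Icc (x - 1) (x + 1)).card := Finset.card_filter_le _ _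
    rw [Pi.card_Icc] at h
    have h' : ∀ i, (Finset.Icc ((x - 1) i) ((x + 1) i)).card = 3 := fun i => by
      rw [Int.card_Icc]; simp only [Pi.add_apply, Pi.sub_apply, Pi.one_apply]; omega
    simp only [h', Finset.prod_const, Finset.card_univ, Fintype.card_fin] at h
    exact_mod_cast h
  rw [boundarySum, ← Finset.sum_sdiff hsub, Finset.sum_eq_zero (s := box ν m) fun x hx => by
    rw [hinner x hx, Finset.sum_empty], add_zero, Finset.mul_sum]
  refine Finset.sum_le_sum fun x hx => ?_
  have hxm := (Finset.mem_sdiff.1 hx).1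
  rw [Finset.sum_const, nsmul_eq_mul]
  have h0 := gibbs_mul_nonneg hK (zero_mem_box (ν := ν) (m + 1)) hxm
  have h1 : gibbs J T (box ν (m + 1)) 0 (fun s => s 0 * s x) ≤ connected μ x := by
    refine (hμ.gibbs_le_integral hK (zero_mem_box _) hxm).trans (le_of_eq ?_)
    rw [hμ.connected_eq]
    simp only [mul_comm]
  refine mul_le_mul ?_ ?_ (mul_nonneg (tanh_nonneg hK) h0) (by positivity)
  · exact (Nat.cast_le.2 (Finset.card_le_card Finset.sdiff_subset)).trans (hcard x)
  · exact (mul_le_of_le_one_left h0 (tanh_le_one _)).trans h1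

end IsFreeState

/-! ### Lattice geometry -/

lemma length_nonneg (x : Site ν) : 0 ≤ length x := Real.sqrt_nonneg _

lemma abs_le_length (x : Site ν) (i : Fin ν) : |(x i : ℝ)| ≤ length x :=
  Real.abs_le_sqrt (Finset.single_le_sum (f := fun i => (x i : ℝ) ^ 2)
    (fun _ _ => sq_nonneg _) (Finset.mem_univ i))

lemma length_le_of_mem_box {m : ℕ} {x : Site ν} (hx : x ∈ box ν m) : length x ≤ ν * m := by
  refine Real.sqrt_le_iff.2 ⟨by positivity, ?_⟩
  calc ∑ i, (x i : ℝ) ^ 2 ≤ ∑ _i : Fin ν, (m : ℝ) ^ 2 := Finset.sum_le_sum fun i _ =>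
        sq_le_sq' (abs_le.1 (by exact_mod_cast mem_box.1 hx i)).1
          (abs_le.1 (by exact_mod_cast mem_box.1 hx i)).2
    _ = ν * (m : ℝ) ^ 2 := by simp
    _ ≤ (ν * m : ℝ) ^ 2 := by
        rw [mul_pow]
        refine mul_le_mul_of_nonneg_right ?_ (by positivity)
        exact_mod_cast Nat.le_self_pow two_ne_zero ν

lemma add_one_le_length_of_notMem_box {m : ℕ} {x : Site ν} (hx : x ∉ box ν m) :
    (m : ℝ) + 1 ≤ length x := by
  rw [mem_box] at hx
  push Not at hx
  obtain ⟨i, hi⟩ := hx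
  have h : (m : ℤ) + 1 ≤ |x i| := hi
  exact le_trans (by exact_mod_cast h) (abs_le_length x i)

lemma box_mono {m n : ℕ} (h : m ≤ n) : box ν m ⊆ box ν n := fun x hx =>
  mem_box.2 fun i => (mem_box.1 hx i).trans (by exact_mod_cast h)

lemma sub_mem_box {m n : ℕ} {x y : Site ν} (hx : x ∈ box ν m) (hy : y ∈ box ν n) :
    x - y ∈ box ν (m + n) := mem_box.2 fun i => by
  have h1 := mem_box.1 hx i
  have h2 := mem_box.1 hy i
  have h3 := abs_sub (x i) (y i)
  rw [Pi.sub_apply]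
  push_cast
  linarith

lemma card_box (ν n : ℕ) : (box ν n).card = (2 * n + 1) ^ ν := by
  have h : ((n : ℤ) + 1 - -(n : ℤ)).toNat = 2 * n + 1 := by omega
  rw [box, Pi.card_Icc]
  simp only [Int.card_Icc, h, Finset.prod_const, Finset.card_univ, Fintype.card_fin]

lemma mem_ball {R : ℝ} {x : Site ν} : x ∈ ball ν R ↔ length x ≤ R := by
  rw [ball, Finset.mem_filter, and_iff_right_iff_imp]
  intro h
  refine mem_box.2 fun i => ?_
  have := ((abs_le_length x i).trans h).trans (Nat.le_ceil R)
  exact_mod_cast this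

lemma ball_subset_box (R : ℝ) : ball ν R ⊆ box ν ⌈R⌉₊ := Finset.filter_subset _ _

lemma card_ball_le {R : ℝ} (hR : 1 ≤ R) : ((ball ν R).card : ℝ) ≤ (5 * R) ^ ν := by
  have h1 : ((ball ν R).card : ℝ) ≤ (box ν ⌈R⌉₊).card :=
    Nat.cast_le.2 (Finset.card_le_card (ball_subset_box R))
  rw [card_box] at h1
  push_cast at h1
  have h2 := Nat.ceil_lt_add_one (zero_le_one.trans hR)
  exact h1.trans (pow_le_pow_left₀ (by positivity) (by linarith) ν)

lemma le_card_ball (hν : 0 < ν) {R : ℝ} (hR : 0 ≤ R) : (R / ν) ^ ν ≤ ((ball ν R).card : ℝ) := by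
  have hν' : (0 : ℝ) < ν := Nat.cast_pos.2 hν
  have hsub : box ν ⌊R / ν⌋₊ ⊆ ball ν R := fun x hx => mem_ball.2 <| by
    have h1 := Nat.floor_le (div_nonneg hR hν'.le)
    calc length x ≤ ν * ⌊R / ν⌋₊ := length_le_of_mem_box hx
      _ ≤ ν * (R / ν) := mul_le_mul_of_nonneg_left h1 hν'.le
      _ = R := by field_simp
  have h1 : ((box ν ⌊R / ν⌋₊).card : ℝ) ≤ (ball ν R).card :=
    Nat.cast_le.2 (Finset.card_le_card hsub)
  rw [card_box] at h1
  push_cast at h1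
  have h2 := Nat.lt_floor_add_one (R / ν)
  refine le_trans (pow_le_pow_left₀ (by positivity) ?_ ν) h1
  have : (0 : ℝ) ≤ ⌊R / ν⌋₊ := Nat.cast_nonneg _
  linarith

lemma pow_sub_pow_le {a b : ℝ} (hb : 0 ≤ b) (hab : b ≤ a) (n : ℕ) :
    a ^ (n + 1) - b ^ (n + 1) ≤ (n + 1) * (a - b) * a ^ n := by
  induction n with
  | zero => simp
  | succ n ih =>
    have h1 : b ^ (n + 1) ≤ a ^ (n + 1) := pow_le_pow_left₀ hb hab _
    have h2 := mul_le_mul_of_nonneg_left ih (hb.trans hab)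
    have h3 := mul_le_mul_of_nonneg_left h1 (sub_nonneg.2 hab)
    push_cast
    calc a ^ (n + 1 + 1) - b ^ (n + 1 + 1)
        = a * (a ^ (n + 1) - b ^ (n + 1)) + (a - b) * b ^ (n + 1) := by ring
      _ ≤ a * ((n + 1) * (a - b) * a ^ n) + (a - b) * a ^ (n + 1) := add_le_add h2 h3
      _ = _ := by ring

/-- The dimension is `n + 1`, so that the surface exponent `ν - 1` is the natural number `n`. -/
lemma card_shell_le (n m : ℕ) : ((box (n + 1) (m + 1) \ box (n + 1) m).card : ℝ) ≤
    2 * (n + 1) * 3 ^ n * ((m : ℝ) + 1) ^ n := by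
  rw [Finset.card_sdiff_of_subset (box_mono m.le_succ), Nat.cast_sub
    (Finset.card_le_card (box_mono m.le_succ)), card_box, card_box]
  push_cast
  have h := pow_sub_pow_le (a := 2 * ((m : ℝ) + 1) + 1) (b := 2 * (m : ℝ) + 1) (by positivity)
    (by linarith) n
  refine h.trans ?_
  have h2 : (2 * ((m : ℝ) + 1) + 1) ^ n ≤ (3 * ((m : ℝ) + 1)) ^ n :=
    pow_le_pow_left₀ (by positivity) (by linarith [(Nat.cast_nonneg m : (0 : ℝ) ≤ m)]) n
  calc _ = 2 * ((n : ℝ) + 1) * (2 * ((m : ℝ) + 1) + 1) ^ n := by ring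
    _ ≤ 2 * ((n : ℝ) + 1) * (3 * ((m : ℝ) + 1)) ^ n :=
        mul_le_mul_of_nonneg_left h2 (by positivity)
    _ = _ := by rw [mul_pow]; ring

/-! ### Sums of functions with a power-law decay -/

/-- A bounded nonnegative function that decays at the exact order `|x|^{-s}`. -/
structure PowerLaw (W : Site ν → ℝ) (s : ℝ) : Prop where
  nonneg : ∀ x, 0 ≤ W x
  le_one : ∀ x, W x ≤ 1
  exponent_nonneg : 0 ≤ s
  lower : ∃ c > 0, ∃ k : ℕ, ∀ x ∉ box ν k, c * length x ^ (-s) ≤ W x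
  upper : ∃ d > 0, ∀ m : ℕ, ∀ x ∉ box ν m, W x ≤ d * ((m : ℝ) + 1) ^ (-s)

namespace PowerLaw

variable {W : Site ν → ℝ} {s : ℝ}

lemma sum_shell_le (hν : 0 < ν) (h : PowerLaw W s) :
    ∃ B > 0, ∀ m : ℕ, ∑ x ∈ box ν (m + 1) \ box ν m, W x ≤ B * ((m : ℝ) + 1) ^ ((ν : ℝ) - 1 - s) := by
  obtain ⟨d, hd, hup⟩ := h.upper
  obtain ⟨n, rfl⟩ : ∃ n, ν = n + 1 := ⟨ν - 1, by omega⟩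
  refine ⟨2 * (n + 1) * 3 ^ n * d, by positivity, fun m => ?_⟩
  have hm : (0 : ℝ) < (m : ℝ) + 1 := by positivity
  calc ∑ x ∈ box (n + 1) (m + 1) \ box (n + 1) m, W x
      ≤ ∑ _x ∈ box (n + 1) (m + 1) \ box (n + 1) m, d * ((m : ℝ) + 1) ^ (-s) :=
        Finset.sum_le_sum fun x hx => hup m x (Finset.mem_sdiff.1 hx).2
    _ = ((box (n + 1) (m + 1) \ box (n + 1) m).card : ℝ) * (d * ((m : ℝ) + 1) ^ (-s)) := by
        rw [Finset.sum_const, nsmul_eq_mul]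
    _ ≤ 2 * (n + 1) * 3 ^ n * ((m : ℝ) + 1) ^ n * (d * ((m : ℝ) + 1) ^ (-s)) :=
        mul_le_mul_of_nonneg_right (card_shell_le n m) (by positivity)
    _ = _ := by
        have : ((n + 1 : ℕ) : ℝ) - 1 - s = n + -s := by push_cast; ring
        rw [this, Real.rpow_add hm, Real.rpow_natCast]
        ring

/-- Because `s ≤ ν - 1`, the shell bounds do not decrease with `m`; `N` copies of the last one plus
`1` for the origin already give the right order. -/
lemma sum_box_le (hν : 0 < ν) (h : PowerLaw W s) (hs : s ≤ (ν : ℝ) - 1) :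
    ∃ B > 0, ∀ N : ℕ, 1 ≤ N → ∑ x ∈ box ν N, W x ≤ B * (N : ℝ) ^ ((ν : ℝ) - s) := by
  obtain ⟨B, hB, hshell⟩ := h.sum_shell_le hν
  refine ⟨1 + B, by positivity, fun N hN => ?_⟩
  have hN' : (1 : ℝ) ≤ N := by exact_mod_cast hN
  have hstep : ∀ M ≤ N, ∑ x ∈ box ν M, W x ≤ 1 + M * (B * (N : ℝ) ^ ((ν : ℝ) - 1 - s)) := by
    intro M hM
    induction M with
    | zero =>
      have : box ν 0 = {0} := by
        ext x
        simp only [mem_box, Finset.mem_singleton, Nat.cast_zero, abs_nonpos_iff]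
        exact ⟨fun h => funext h, fun h i => congrFun h i⟩
      simpa [this] using h.le_one 0
    | succ M ih =>
      have h1 := ih (by omega)
      have h2 := hshell M
      have h3 : ((M : ℝ) + 1) ^ ((ν : ℝ) - 1 - s) ≤ (N : ℝ) ^ ((ν : ℝ) - 1 - s) :=
        Real.rpow_le_rpow (by positivity) (by exact_mod_cast hM) (by linarith)
      have h4 := mul_le_mul_of_nonneg_left h3 hB.le
      rw [← Finset.sum_sdiff (box_mono M.le_succ)]
      push_cast
      linarith
  have h1 : (N : ℝ) * (N : ℝ) ^ ((ν : ℝ) - 1 - s) = (N : ℝ) ^ ((ν : ℝ) - s) := by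
    have h0 : (0 : ℝ) < N := by linarith
    rw [← Real.rpow_one_add' h0.le (by linarith)]
    congr 1; ring
  calc ∑ x ∈ box ν N, W x ≤ 1 + N * (B * (N : ℝ) ^ ((ν : ℝ) - 1 - s)) := hstep N le_rfl
    _ = 1 + B * (N : ℝ) ^ ((ν : ℝ) - s) := by rw [← h1]; ring
    _ ≤ (1 + B) * (N : ℝ) ^ ((ν : ℝ) - s) := by
        have := Real.one_le_rpow hN' (by linarith : 0 ≤ (ν : ℝ) - s)
        linarith

lemma sum_ball_le (hν : 0 < ν) (h : PowerLaw W s) (hs : s ≤ (ν : ℝ) - 1) :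
    ∃ C > 0, ∀ R : ℝ, 1 ≤ R →
      ∑ x ∈ ball ν R, ∑ y ∈ ball ν R, W (x - y) ≤ C * R ^ (2 * (ν : ℝ) - s) := by
  obtain ⟨B, hB, hbox⟩ := h.sum_box_le hν hs
  refine ⟨5 ^ ν * (B * 4 ^ ((ν : ℝ) - s)), by positivity, fun R hR => ?_⟩
  have hR0 : 0 < R := by linarith
  set N := ⌈R⌉₊ with hNdef
  have hN : 1 ≤ N := Nat.one_le_ceil_iff.2 hR0
  have hN4 : ((N + N : ℕ) : ℝ) ≤ 4 * R := by
    have := Nat.ceil_lt_add_one hR0.le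
    push_cast; linarith
  have hinner : ∀ x ∈ ball ν R, ∑ y ∈ ball ν R, W (x - y) ≤ B * (4 * R) ^ ((ν : ℝ) - s) := by
    intro x hx
    calc ∑ y ∈ ball ν R, W (x - y) = ∑ z ∈ (ball ν R).image (x - ·), W z :=
          (Finset.sum_image fun _ _ _ _ h => sub_right_injective h).symm
      _ ≤ ∑ z ∈ box ν (N + N), W z := by
          refine Finset.sum_le_sum_of_subset_of_nonneg (fun z hz => ?_) fun z _ _ => h.nonneg z
          obtain ⟨y, hy, rfl⟩ := Finset.mem_image.1 hz
          exact sub_mem_box (ball_subset_box R hx) (ball_subset_box R hy)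
      _ ≤ B * ((N + N : ℕ) : ℝ) ^ ((ν : ℝ) - s) := hbox _ (by omega)
      _ ≤ B * (4 * R) ^ ((ν : ℝ) - s) := mul_le_mul_of_nonneg_left
          (Real.rpow_le_rpow (Nat.cast_nonneg _) hN4 (by linarith)) hB.le
  calc ∑ x ∈ ball ν R, ∑ y ∈ ball ν R, W (x - y)
      ≤ ∑ _x ∈ ball ν R, B * (4 * R) ^ ((ν : ℝ) - s) := Finset.sum_le_sum hinner
    _ = (ball ν R).card * (B * (4 * R) ^ ((ν : ℝ) - s)) := by rw [Finset.sum_const, nsmul_eq_mul]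
    _ ≤ (5 * R) ^ ν * (B * (4 * R) ^ ((ν : ℝ) - s)) :=
        mul_le_mul_of_nonneg_right (card_ball_le hR) (by positivity)
    _ = _ := by
        have : 2 * (ν : ℝ) - s = ν + (ν - s) := by ring
        rw [this, Real.rpow_add hR0, Real.rpow_natCast, mul_pow,
          Real.mul_rpow (by norm_num) hR0.le]
        ring

/-- Two points of the ball are at distance at most `4νR`, so, `s` being nonnegative, each pair with
`x - y` outside the exceptional cube contributes at least a multiple of `R ^ (-s)`. There are of
order `R ^ (2ν)` such pairs. -/
lemma le_sum_ball (hν : 0 < ν) (h : PowerLaw W s) :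
    ∃ C > 0, ∀ᶠ R : ℝ in atTop,
      C * R ^ (2 * (ν : ℝ) - s) ≤ ∑ x ∈ ball ν R, ∑ y ∈ ball ν R, W (x - y) := by
  obtain ⟨c, hc, k, hlow⟩ := h.lower
  have hν' : (0 : ℝ) < ν := Nat.cast_pos.2 hν
  refine ⟨(1 / ν) ^ ν * ((1 / ν) ^ ν / 2 * (c * (4 * ν) ^ (-s))), by positivity, ?_⟩
  -- The second threshold makes the exceptional cube hold at most half of the `(R / ν) ^ ν`
  -- guaranteed points of the ball.
  filter_upwards [eventually_ge_atTop 1, eventually_ge_atTop (ν * (2 * (2 * (k : ℝ) + 1)))]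
    with R hR hRk
  have hR0 : 0 < R := by linarith
  have hN4 : ((⌈R⌉₊ + ⌈R⌉₊ : ℕ) : ℝ) ≤ 4 * R := by
    have := Nat.ceil_lt_add_one hR0.le
    push_cast; linarith
  have hcard := le_card_ball hν hR0.le
  have hkcard : ((box ν k).card : ℝ) ≤ (R / ν) ^ ν / 2 := by
    rw [card_box, le_div_iff₀ two_pos]
    push_cast
    calc (2 * (k : ℝ) + 1) ^ ν * 2 ≤ (2 * (k : ℝ) + 1) ^ ν * 2 ^ ν :=
          mul_le_mul_of_nonneg_left (by simpa using pow_le_pow_right₀ one_le_two hν)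
            (by positivity)
      _ = (2 * (2 * (k : ℝ) + 1)) ^ ν := by rw [← mul_pow]; ring
      _ ≤ (R / ν) ^ ν := pow_le_pow_left₀ (by positivity) ((le_div_iff₀' hν').2 hRk) ν
  have hinner : ∀ x ∈ ball ν R,
      (R / ν) ^ ν / 2 * (c * (4 * ν * R) ^ (-s)) ≤ ∑ y ∈ ball ν R, W (x - y) := by
    intro x hx
    set A := (ball ν R).filter fun y => x - y ∉ box ν k with hA
    have hAcard : (R / ν) ^ ν / 2 ≤ (A.card : ℝ) := by
      have h1 : ((ball ν R).filter fun y => x - y ∈ box ν k).card ≤ (box ν k).card :=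
        Finset.card_le_card_of_injOn (x - ·) (fun y hy => (Finset.mem_filter.1 hy).2)
          fun _ _ _ _ h => sub_right_injective h
      have h2 : ((ball ν R).filter fun y => x - y ∈ box ν k).card + A.card = (ball ν R).card :=
        Finset.card_filter_add_card_filter_not _
      have h3 : (((ball ν R).filter fun y => x - y ∈ box ν k).card : ℝ) + A.card =
        (ball ν R).card := by exact_mod_cast h2
      have h4 : (((ball ν R).filter fun y => x - y ∈ box ν k).card : ℝ) ≤ (box ν k).card := by
        exact_mod_cast h1
      linarith
    calc (R / ν) ^ ν / 2 * (c * (4 * ν * R) ^ (-s)) ≤ A.card * (c * (4 * ν * R) ^ (-s)) :=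
          mul_le_mul_of_nonneg_right hAcard (by positivity)
      _ = ∑ _y ∈ A, c * (4 * ν * R) ^ (-s) := by rw [Finset.sum_const, nsmul_eq_mul]
      _ ≤ ∑ y ∈ A, W (x - y) := by
          refine Finset.sum_le_sum fun y hy => ?_
          obtain ⟨hyb, hyk⟩ := Finset.mem_filter.1 hy
          refine le_trans (mul_le_mul_of_nonneg_left ?_ hc.le) (hlow _ hyk)
          have h1 := add_one_le_length_of_notMem_box hyk
          have h2 : length (x - y) ≤ 4 * ν * R := by
            refine (length_le_of_mem_box (sub_mem_box (ball_subset_box R hx)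
              (ball_subset_box R hyb))).trans ?_
            have := mul_le_mul_of_nonneg_left hN4 hν'.le
            linarith
          exact Real.rpow_le_rpow_of_nonpos (lt_of_lt_of_le (by positivity) h1) h2
            (neg_nonpos.2 h.exponent_nonneg)
      _ ≤ ∑ y ∈ ball ν R, W (x - y) :=
          Finset.sum_le_sum_of_subset_of_nonneg (Finset.filter_subset _ _)
            fun y _ _ => h.nonneg _
  calc (1 / ν) ^ ν * ((1 / ν) ^ ν / 2 * (c * (4 * ν) ^ (-s))) * R ^ (2 * (ν : ℝ) - s)
      = (R / ν) ^ ν * ((R / ν) ^ ν / 2 * (c * (4 * ν * R) ^ (-s))) := by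
        have : 2 * (ν : ℝ) - s = ν + (ν + -s) := by ring
        rw [this, Real.rpow_add hR0, Real.rpow_add hR0, Real.rpow_natCast,
          Real.mul_rpow (x := 4 * (ν : ℝ)) (by positivity) hR0.le]
        simp only [div_eq_mul_inv, mul_pow, one_mul]
        ring
    _ ≤ (ball ν R).card * ((R / ν) ^ ν / 2 * (c * (4 * ν * R) ^ (-s))) :=
        mul_le_mul_of_nonneg_right hcard (by positivity)
    _ = ∑ _x ∈ ball ν R, (R / ν) ^ ν / 2 * (c * (4 * ν * R) ^ (-s)) := by
        rw [Finset.sum_const, nsmul_eq_mul]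
    _ ≤ _ := Finset.sum_le_sum hinner

end PowerLaw

/-! ### Power law of the critical two-point function -/

lemma notMem_box_const (hν : 0 < ν) {k n : ℕ} (h : k < n) :
    (fun _ => (n : ℤ) : Site ν) ∉ box ν k := fun hx => by
  have := mem_box.1 hx ⟨0, hν⟩
  simp only [Nat.abs_cast, Nat.cast_le] at this
  omega

lemma eventually_comap_length {p : Site ν → Prop} :
    (∀ᶠ x in comap length atTop, p x) ↔ ∃ r : ℝ, ∀ x, r ≤ length x → p x := by
  rw [eventually_comap, eventually_atTop]
  exact ⟨fun ⟨r, h⟩ => ⟨r, fun x hx => h _ hx x rfl⟩, fun ⟨r, h⟩ => ⟨r, fun b hb x hx =>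
    h x (hx ▸ hb)⟩⟩

lemma StandardAssumption.powerLaw (hν : 0 < ν) {J T η : ℝ} {μ : Measure (Config ν)}
    (hη : StandardAssumption μ η) (hμ : IsFreeState ν J T μ) (hK : 0 ≤ J / T) :
    PowerLaw (connected μ) ((ν : ℝ) - 2 + η) := by
  set s := (ν : ℝ) - 2 + η
  have hΘ : connected μ =Θ[comap length atTop] fun x : Site ν => length x ^ (-s) := hη
  have hpow : ∀ x : Site ν, 0 ≤ length x ^ (-s) := fun x => Real.rpow_nonneg (length_nonneg x) _
  obtain ⟨C, hC, h1⟩ := hΘ.1.exists_pos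
  obtain ⟨D, hD, h2⟩ := hΘ.2.exists_pos
  obtain ⟨r₁, h1⟩ := eventually_comap_length.1 h1.bound
  obtain ⟨r₂, h2⟩ := eventually_comap_length.1 h2.bound
  simp only [Real.norm_of_nonneg (hpow _), Real.norm_of_nonneg (hμ.connected_nonneg hK _)] at h1 h2
  -- A negative `s` would force `W` to grow without bound along the diagonal, against `W ≤ 1`.
  have hs : 0 ≤ s := by
    by_contra! hs
    have ht : Tendsto (fun n : ℕ => ((n : ℝ) + 1) ^ (-s)) atTop atTop :=
      (tendsto_rpow_atTop (neg_pos.2 hs)).comp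
        (tendsto_atTop_add_const_right _ _ tendsto_natCast_atTop_atTop)
    obtain ⟨n, hn, hn'⟩ := ((ht.eventually_gt_atTop D).and
      (eventually_ge_atTop ⌈r₂⌉₊)).exists
    have hx := add_one_le_length_of_notMem_box (notMem_box_const hν n.lt_succ_self)
    have h3 := h2 _ (((Nat.le_ceil r₂).trans (Nat.cast_le.2 hn')).trans
      ((le_add_of_nonneg_right zero_le_one).trans hx))
    have h4 := Real.rpow_le_rpow (by positivity) hx (neg_pos.2 hs).le
    have h5 := mul_le_of_le_one_right hD.le (hμ.connected_le_one (fun _ => ((n + 1 : ℕ) : ℤ)))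
    linarith
  -- In the upper constant, `C` serves the sites of length at least `r₁`; the other term makes the
  -- bound at least `1` at the shorter ones, where `W ≤ 1` suffices. The maximum with `1` keeps the
  -- base positive.
  refine ⟨hμ.connected_nonneg hK, hμ.connected_le_one, hs,
    ⟨D⁻¹, inv_pos.2 hD, ⌈r₂⌉₊, fun x hx => ?_⟩, ⟨C + (max r₁ 1) ^ s, by positivity, fun m x hx => ?_⟩⟩
  · rw [inv_mul_le_iff₀ hD]
    refine h2 x ((Nat.le_ceil r₂).trans ?_)
    linarith [add_one_le_length_of_notMem_box hx]
  · have hm : (0 : ℝ) < (m : ℝ) + 1 := by positivity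
    have hlen := add_one_le_length_of_notMem_box hx
    have hmax : (0 : ℝ) < max r₁ 1 := lt_max_of_lt_right one_pos
    rw [add_mul]
    have hA : 0 ≤ C * ((m : ℝ) + 1) ^ (-s) := by positivity
    have hB : 0 ≤ (max r₁ 1) ^ s * ((m : ℝ) + 1) ^ (-s) := by positivity
    rcases le_or_gt r₁ (length x) with h | h
    · have h3 := mul_le_mul_of_nonneg_left
        (Real.rpow_le_rpow_of_nonpos hm hlen (neg_nonpos.2 hs)) hC.le
      linarith [h1 x h]
    · have h3 : 1 ≤ (max r₁ 1) ^ s * ((m : ℝ) + 1) ^ (-s) := by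
        rw [Real.rpow_neg hm.le, ← div_eq_mul_inv, one_le_div (by positivity)]
        exact Real.rpow_le_rpow hm.le ((hlen.trans h.le).trans (le_max_left _ _)) hs
      linarith [hμ.connected_le_one x]

/-- A two-point function with a power-law decay excludes `T_c = 0`, where it would vanish off the
origin. -/
lemma criticalTemp_pos (hν : 0 < ν) {J η : ℝ} {μ : Measure (Config ν)}
    (hμ : IsCriticalState ν J μ) (hη : StandardAssumption μ η) : 0 < criticalTemp ν J := by
  refine (criticalTemp_nonneg ν J).lt_of_ne fun h0 => ?_
  rw [IsCriticalState, ← h0] at hμ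
  obtain ⟨c, hc, k, hlow⟩ := (hη.powerLaw hν hμ (by simp)).lower
  have hx := notMem_box_const hν k.lt_succ_self
  have hne : (fun _ => ((k + 1 : ℕ) : ℤ) : Site ν) ≠ 0 := fun h => hx (h ▸ zero_mem_box k)
  have h1 := hlow _ hx
  have h2 := hμ.tendsto_gibbs (fun _ => ((k + 1 : ℕ) : ℤ)) 0
  simp only [gibbs_zero_temp_mul J _ hne] at h2
  have h4 := tendsto_nhds_unique h2 tendsto_const_nhds
  rw [← hμ.connected_eq] at h4
  have hlen : 0 < length (fun _ => ((k + 1 : ℕ) : ℤ) : Site ν) :=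
    lt_of_lt_of_le (by positivity) (add_one_le_length_of_notMem_box hx)
  have h3 := mul_pos hc (Real.rpow_pos_of_pos hlen (-((ν : ℝ) - 2 + η)))
  linarith

lemma IsCriticalState.one_le_sum_shell {J : ℝ} (hJ : 0 ≤ J) {μ : Measure (Config ν)}
    (hμ : IsCriticalState ν J μ) (hT : 0 < criticalTemp ν J) (m : ℕ) :
    1 ≤ 3 ^ ν * ∑ x ∈ box ν (m + 1) \ box ν m, connected μ x :=
  (one_le_boundarySum hJ hT (m + 1)).trans
    (IsFreeState.boundarySum_le hμ (div_nonneg hJ hT.le) m)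

lemma tendsto_box_atTop (ν : ℕ) : Tendsto (box ν) atTop atTop :=
  tendsto_atTop.2 fun S => eventually_subset_box S

lemma not_summable_of_le_sum_shell {W : Site ν → ℝ} {ε : ℝ} (hε : 0 < ε)
    (h : ∀ m : ℕ, ε ≤ ∑ x ∈ box ν (m + 1) \ box ν m, W x) : ¬ Summable W := fun hW => by
  have h1 := hW.hasSum.comp (tendsto_box_atTop ν)
  have h2 := ((tendsto_add_atTop_iff_nat 1).2 h1).sub h1
  rw [sub_self] at h2
  refine hε.not_ge (ge_of_tendsto' h2 fun m => (h m).trans (le_of_eq ?_))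
  rw [Function.comp_apply, Function.comp_apply, ← Finset.sum_sdiff (box_mono m.le_succ),
    add_sub_cancel_right]

/-- For `s > ν - 1` the shell sums would tend to zero. -/
lemma PowerLaw.exponent_le (hν : 0 < ν) {W : Site ν → ℝ} {s ε : ℝ} (hW : PowerLaw W s)
    (hε : 0 < ε) (h : ∀ m : ℕ, ε ≤ ∑ x ∈ box ν (m + 1) \ box ν m, W x) : s ≤ (ν : ℝ) - 1 := by
  by_contra! hs
  obtain ⟨B, -, hB⟩ := hW.sum_shell_le hν
  have h1 : Tendsto (fun m : ℕ => B * ((m : ℝ) + 1) ^ ((ν : ℝ) - 1 - s)) atTop (𝓝 (B * 0)) := by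
    refine Tendsto.const_mul B (Tendsto.comp (g := fun t : ℝ => t ^ ((ν : ℝ) - 1 - s)) ?_
      (tendsto_atTop_add_const_right _ 1 tendsto_natCast_atTop_atTop))
    have := tendsto_rpow_neg_atTop (y := s - ((ν : ℝ) - 1)) (by linarith)
    rwa [neg_sub] at this
  rw [mul_zero] at h1
  exact hε.not_ge (ge_of_tendsto' h1 fun m => (h m).trans (hB m))

/-! ### Fluctuations and the main theorem -/

lemma IsCutoff.exists_bound {f : ℝ → ℝ} (hf : IsCutoff f) :
    ∃ M, 0 < M ∧ ∀ t, 0 ≤ t → f t ≤ M := by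
  obtain ⟨M, hM⟩ := isCompact_Icc.exists_bound_of_continuousOn
    (hf.smooth.continuousOn.mono (Set.Icc_subset_Ici_self : Set.Icc (0 : ℝ) 2 ⊆ _))
  have h1 : 1 ≤ M := by simpa [hf.eq_one 0 le_rfl zero_le_one] using hM 0 (by simp)
  refine ⟨M, by linarith, fun t ht => ?_⟩
  rcases le_or_gt t 2 with h | h
  · exact (le_abs_self _).trans (hM t ⟨ht, h⟩)
  · rw [hf.eq_zero t h.le]; linarith

lemma fluctuation_eq {J T : ℝ} {μ : Measure (Config ν)} (hμ : IsFreeState ν J T μ) {f : ℝ → ℝ}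
    (hf : IsCutoff f) (α : ℝ) {R : ℝ} (hR : 0 < R) (σ : Config ν) :
    fluctuation μ f α R σ =
      R ^ (-α) * ∑ x ∈ ball ν (2 * R), f (length x / R) * spin x σ := by
  rw [fluctuation, tsum_eq_sum (s := ball ν (2 * R))]
  · simp only [hμ.integral_spin, sub_zero, mul_comm]
  · intro x hx
    rw [mem_ball, not_le] at hx
    rw [hf.eq_zero _ ((le_div_iff₀ hR).2 hx.le), mul_zero]

lemma integral_fluctuation_sq {J T : ℝ} {μ : Measure (Config ν)} (hμ : IsFreeState ν J T μ)
    (hK : 0 ≤ J / T) {f : ℝ → ℝ} (hf : IsCutoff f) (α : ℝ) {R : ℝ} (hR : 0 < R) :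
    ∫ σ, fluctuation μ f α R σ ^ 2 ∂μ = R ^ (-(2 * α)) *
      ∑ x ∈ ball ν (2 * R), ∑ y ∈ ball ν (2 * R),
        f (length x / R) * f (length y / R) * connected μ (x - y) := by
  simp only [fluctuation_eq hμ hf α hR, mul_pow]
  rw [integral_const_mul, hμ.integral_sum_sq hK]
  congr 1
  rw [← Real.rpow_natCast, ← Real.rpow_mul hR.le]
  congr 1
  push_cast; ring

end Ising

open Ising in
theorem mainTheorem1 (ν : ℕ) (hν : 2 ≤ ν) (J : ℝ) (hJ : 0 < J)
    (μ : Measure (Ising.Config ν)) (hμ : Ising.IsCriticalState ν J μ)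
    (η : ℝ) (hη : Ising.StandardAssumption μ η) :
    ¬ Summable (Ising.connected μ) ∧
    ∃ α : ℝ, α = ((ν : ℝ) + 2 - η) / 2 ∧ (ν : ℝ) / 2 < α ∧
      (∀ f : ℝ → ℝ, Ising.IsCutoff f →
        ∃ c d : ℝ, 0 < c ∧ 0 < d ∧ ∀ᶠ R : ℝ in atTop,
          c ≤ ∫ σ, Ising.fluctuation μ f α R σ ^ 2 ∂μ ∧
          ∫ σ, Ising.fluctuation μ f α R σ ^ 2 ∂μ ≤ d) ∧
      (fun R : ℝ => Ising.blockVariance μ (Ising.ball ν R))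
        =Θ[atTop] fun R : ℝ => ((Ising.ball ν R).card : ℝ) ^ (2 * α / (ν : ℝ)) := by
  have hν0 : 0 < ν := by omega
  have hν' : (0 : ℝ) < ν := Nat.cast_pos.2 hν0
  have hT := criticalTemp_pos hν0 hμ hη
  have hK : 0 ≤ J / criticalTemp ν J := div_nonneg hJ.le hT.le
  have hfree : IsFreeState ν J (criticalTemp ν J) μ := hμ
  have hW := hη.powerLaw hν0 hfree hK
  have hshell : ∀ m : ℕ, ((3 : ℝ) ^ ν)⁻¹ ≤ ∑ x ∈ box ν (m + 1) \ box ν m, connected μ x :=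
    fun m => by
      rw [inv_le_iff_one_le_mul₀' (by positivity)]
      exact hμ.one_le_sum_shell hJ.le hT m
  have hε : (0 : ℝ) < (3 ^ ν)⁻¹ := by positivity
  have hs := hW.exponent_le hν0 hε hshell
  obtain ⟨C, hC, hup⟩ := hW.sum_ball_le hν0 hs
  obtain ⟨c, hc, hlow⟩ := hW.le_sum_ball hν0
  -- The bound `hs` says `η ≤ 1`, hence `α ≥ (ν + 1) / 2`.
  refine ⟨not_summable_of_le_sum_shell hε hshell, _, rfl, by linarith, fun f hf => ?_, ?_⟩
  · obtain ⟨M, hM, hfM⟩ := hf.exists_bound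
    set α := ((ν : ℝ) + 2 - η) / 2 with hα
    have hexp : 2 * (ν : ℝ) - (ν - 2 + η) = 2 * α := by rw [hα]; ring
    rw [hexp] at hup hlow
    refine ⟨c, M * M * (C * 2 ^ (2 * α)), hc, by positivity, ?_⟩
    filter_upwards [hlow, eventually_ge_atTop 1] with R hR hR1
    have hR0 : 0 < R := by linarith
    have hinv : R ^ (-(2 * α)) * R ^ (2 * α) = 1 := by
      rw [← Real.rpow_add hR0, neg_add_cancel, Real.rpow_zero]
    have hpos : 0 < R ^ (-(2 * α)) := Real.rpow_pos_of_pos hR0 _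
    have hf0 : ∀ x : Site ν, 0 ≤ f (length x / R) := fun x =>
      hf.nonneg _ (div_nonneg (length_nonneg x) hR0.le)
    have hfM' : ∀ x : Site ν, f (length x / R) ≤ M := fun x =>
      hfM _ (div_nonneg (length_nonneg x) hR0.le)
    have hterm : ∀ x y : Site ν,
        0 ≤ f (length x / R) * f (length y / R) * connected μ (x - y) := fun x y =>
      mul_nonneg (mul_nonneg (hf0 x) (hf0 y)) (hW.nonneg _)
    have hball : ball ν R ⊆ ball ν (2 * R) := fun x hx =>
      mem_ball.2 ((mem_ball.1 hx).trans (by linarith))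
    have hone : ∀ x ∈ ball ν R, f (length x / R) = 1 := fun x hx =>
      hf.eq_one _ (div_nonneg (length_nonneg x) hR0.le) ((div_le_one hR0).2 (mem_ball.1 hx))
    rw [integral_fluctuation_sq hfree hK hf α hR0]
    constructor
    -- All terms are nonnegative, so the sum may be restricted to the ball of radius `R`, where the
    -- cutoff is `1`.
    · calc c = R ^ (-(2 * α)) * (c * R ^ (2 * α)) := by rw [mul_left_comm, hinv, mul_one]
        _ ≤ R ^ (-(2 * α)) * ∑ x ∈ ball ν R, ∑ y ∈ ball ν R, connected μ (x - y) :=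
          mul_le_mul_of_nonneg_left hR hpos.le
        _ = R ^ (-(2 * α)) * ∑ x ∈ ball ν R, ∑ y ∈ ball ν R,
            f (length x / R) * f (length y / R) * connected μ (x - y) := by
          congr 1
          refine Finset.sum_congr rfl fun x hx => Finset.sum_congr rfl fun y hy => ?_
          rw [hone x hx, hone y hy, one_mul, one_mul]
        _ ≤ _ := by
          refine mul_le_mul_of_nonneg_left ?_ hpos.le
          refine (Finset.sum_le_sum fun x _ => Finset.sum_le_sum_of_subset_of_nonneg hball
            fun y _ _ => hterm x y).trans ?_
          exact Finset.sum_le_sum_of_subset_of_nonneg hball fun x _ _ =>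
            Finset.sum_nonneg fun y _ => hterm x y
    · calc
        _ ≤ R ^ (-(2 * α)) * ∑ x ∈ ball ν (2 * R), ∑ y ∈ ball ν (2 * R),
            M * M * connected μ (x - y) := by
          refine mul_le_mul_of_nonneg_left ?_ hpos.le
          refine Finset.sum_le_sum fun x _ => Finset.sum_le_sum fun y _ => ?_
          exact mul_le_mul_of_nonneg_right
            (mul_le_mul (hfM' x) (hfM' y) (hf0 y) hM.le) (hW.nonneg _)
        _ = R ^ (-(2 * α)) * (M * M * ∑ x ∈ ball ν (2 * R), ∑ y ∈ ball ν (2 * R),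
            connected μ (x - y)) := by simp only [Finset.mul_sum]
        _ ≤ R ^ (-(2 * α)) * (M * M * (C * (2 * R) ^ (2 * α))) :=
          mul_le_mul_of_nonneg_left (mul_le_mul_of_nonneg_left (hup _ (by linarith))
            (by positivity)) hpos.le
        _ = M * M * (C * 2 ^ (2 * α)) * (R ^ (-(2 * α)) * R ^ (2 * α)) := by
          rw [Real.mul_rpow two_pos.le hR0.le]; ring
        _ = _ := by rw [hinv, mul_one]
  · set α := ((ν : ℝ) + 2 - η) / 2 with hα
    have hexp : 2 * (ν : ℝ) - (ν - 2 + η) = 2 * α := by rw [hα]; ring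
    have hα0 : 0 ≤ 2 * α / ν := div_nonneg (by rw [hα]; linarith) hν'.le
    rw [hexp] at hup hlow
    -- Translates the order `R ^ (2 * α)` into a power of the volume, the ball having between `(R /
    -- ν) ^ ν` and `(5 * R) ^ ν` points.
    have hpow : ∀ t : ℝ, 0 ≤ t → (t ^ ν) ^ (2 * α / (ν : ℝ)) = t ^ (2 * α) := fun t ht => by
      rw [← Real.rpow_natCast, ← Real.rpow_mul ht]
      congr 1
      field_simp
    have hV : (fun R : ℝ => blockVariance μ (ball ν R)) =Θ[atTop] fun R : ℝ => R ^ (2 * α) := by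
      simp only [hfree.blockVariance_eq hK]
      have h0 : ∀ R : ℝ, 0 ≤ ∑ x ∈ ball ν R, ∑ y ∈ ball ν R, connected μ (x - y) := fun R =>
        Finset.sum_nonneg fun x _ => Finset.sum_nonneg fun y _ => hW.nonneg _
      refine ⟨IsBigO.of_bound C ?_, IsBigO.of_bound c⁻¹ ?_⟩
      · filter_upwards [eventually_ge_atTop 1] with R hR
        rw [Real.norm_of_nonneg (h0 R), Real.norm_of_nonneg (by positivity)]
        exact hup R hR
      · filter_upwards [eventually_ge_atTop 1, hlow] with R hR hR'
        rw [Real.norm_of_nonneg (h0 R), Real.norm_of_nonneg (by positivity),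
          le_inv_mul_iff₀ hc]
        exact hR'
    refine hV.trans (IsTheta.symm ⟨IsBigO.of_bound (5 ^ (2 * α)) ?_,
      IsBigO.of_bound ((ν : ℝ) ^ (2 * α)) ?_⟩)
    · filter_upwards [eventually_ge_atTop 1] with R hR
      have hR0 : 0 ≤ R := by linarith
      rw [Real.norm_of_nonneg (by positivity), Real.norm_of_nonneg (by positivity),
        ← Real.mul_rpow (by norm_num) hR0, ← hpow _ (by positivity)]
      exact Real.rpow_le_rpow (Nat.cast_nonneg _) (card_ball_le hR) hα0
    · filter_upwards [eventually_ge_atTop 1] with R hR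
      have hR0 : 0 ≤ R := by linarith
      rw [Real.norm_of_nonneg (by positivity), Real.norm_of_nonneg (by positivity)]
      have h1 := Real.rpow_le_rpow (by positivity) (le_card_ball hν0 hR0) hα0
      rw [hpow _ (by positivity), Real.div_rpow hR0 hν'.le, div_le_iff₀' (by positivity)] at h1
      exact h1
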